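/- Setting. Fix an observation $x$ and $\alpha\in[0,1)$. Let $\Theta\subseteq\mathbb R^a$, $\Phi\subseteq\mathbb R^b$ be open and let $\nu$ be a $\sigma$-finite Borel measure on $\mathbb R^d$. For $\theta\in\Theta,\phi\in\Phi$ let $p_\theta(x,\cdot)\ge 0$ and $q_\phi(\cdot|x)\ge0$ be functions on $\mathbb R^d$ with $p_\theta(x):=\int p_\theta(x,z)\,\nu(\mathrm dz)<\infty$, $\int q_\phi(z|x)\,\nu(\mathrm dz)=1$, and $q_\phi(z|x)>0$, $p_\theta(z|x):=p_\theta(x,z)/p_\theta(x)>0$ for $\nu$-a.e. $z$. Assume that $\theta\mapsto p_\theta(x)$, $(z,\theta)\mapsto p_\theta(z|x)$ and $(z,\phi)\mapsto q_\phi(z|x)$ are differentiable on $\Theta$, $\mathbb R^d\times\Theta$, $\mathbb R^d\times\Phi$. Let $\varepsilon$ be a random element whose law does not depend on the parameters, such that $f(\varepsilon,\phi)$ has density $q_\phi(\cdot|x)$ with respect to $\nu$ for every $\phi\in\Phi$ and a.s. $\phi\mapsto f(\varepsilon,\phi)$ is differentiable on $\Phi$. Put $w_{\theta,\phi}(z)=p_\theta(x,z)/q_\phi(z|x)$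 and $\tilde w=\tilde w_{\theta,\phi}(\varepsilon)=w_{\theta,\phi}(f(\varepsilon,\phi))$. Let $\psi$ be one of the coordinates of $(\theta,\phi)$, let $\partial_\psi$ be the corresponding partial derivative, and define $$\mathrm{VR}^{(\alpha)}(\theta,\phi)=\tfrac1{1-\alpha}\log\mathbb E_{Z\sim q_\phi(\cdot|x)}\big(w_{\theta,\phi}(Z)^{1-\alpha}\big),\qquad \gamma_\alpha(\theta,\phi)^2=\tfrac1{1-\alpha}\mathbb V_{Z\sim q_\phi(\cdot|x)}\Big(\tfrac{w_{\theta,\phi}(Z)^{1-\alpha}}{\mathbb E_{Z'\sim q_\phi(\cdot|x)}(w_{\theta,\phi}(Z')^{1-\alpha})}\Big),$$ $$v_{\mathrm{REP}}(\theta,\phi)=\tfrac1{(1-\alpha)^2}\mathbb V\Big(\partial_\psi\Big(\tfrac{\tilde w^{1-\alpha}}{\mathbb E(\tilde w^{1-\alpha})}\Big)\Big).$$ For i.i.d. copies $\varepsilon_{m,j}$ of $\varepsilon$, with $\tilde w_{m,j}=\tilde w_{\theta,\phi}(\varepsilon_{m,j})$, the REP gradient estimator is $$G_{M,N}=\frac1M\sum_{m=1}^M\sum_{j=1}^N\frac{\tilde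 w_{m,j}^{1-\alpha}}{\sum_{\ell=1}^N\tilde w_{m,\ell}^{1-\alpha}}\,\partial_\psi\log\tilde w_{m,j},$$ and $\mathrm{SNR}[X]=|\mathbb E X|/\sqrt{\mathbb V X}$. Theorem. Let $(\theta,\phi)\in\Theta\times\Phi$ and assume: (i) there are $\mu>1$, $N\ge1$ with $\mathbb E\big(|N^{-1}\sum_{j=1}^N\tilde w(\varepsilon_j)^{1-\alpha}|^{-\mu}\big)<\infty$ for i.i.d. copies $\varepsilon_j$ of $\varepsilon$; (ii) $\mathbb E(\tilde w^{(1-\alpha)h})<\infty$ and $\mathbb E(|\partial_\psi(\tilde w^{1-\alpha})|^{h'})<\infty$ for some $h,h'>2$; (iii) every $(\theta_0,\phi_0)\in\Theta\times\Phi$ has a $\psi$-neighborhood $\mathcal V\subseteq\Theta\times\Phi$ (a set containing all points obtained from $(\theta_0,\phi_0)$ by changing the coordinate $\psi$ by less than some $r>0$) such that a.s. $p_{\theta'}(x,f(\varepsilon,\phi'))>0$ and $q_{\phi'}(f(\varepsilon,\phi')|x)>0$ for all $(\theta',\phi')\in\mathcal V$, and for $\ell=0,1,2$ $$\mathbb E\Big(\sup_{(\theta',\phi')\in\mathcal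 V}\big|\tilde w_{\theta',\phi'}(\varepsilon)^{\ell(1-\alpha)}\,\partial_{\psi}\log\tilde w_{\theta',\phi'}(\varepsilon)\big|\Big)<\infty .$$ Then the derivatives $\partial_\psi\mathrm{VR}^{(\alpha)}$, $\partial_\psi[\gamma_\alpha^2]$ at $(\theta,\phi)$ and, a.s., $\partial_\psi\log\tilde w$ and $\partial_\psi(\tilde w^{1-\alpha}/\mathbb E(\tilde w^{1-\alpha}))$ at $(\theta,\phi)$ exist, the last of these has a finite second moment, $G_{M,N}$ has a finite second moment for all large $N$ and all $M\ge1$, and as $N\to\infty$ $$\mathrm{SNR}[G_{M,N}]=\sqrt{MN}\;\frac{\big|\partial_\psi\mathrm{VR}^{(\alpha)}(\theta,\phi)-\frac1{2N}\partial_\psi[\gamma_\alpha(\theta,\phi)^2]+o(\frac1N)\big|}{\sqrt{v_{\mathrm{REP}}(\theta,\phi)}+o(1)},$$ where the terms $o(1/N)$ and $o(1)$ do not depend on $M$ and the equality holds for all $N$ larger than some $N_0$ that does not depend on $M$ (with the convention $c/0=0$ where the variance vanishes). -/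

import Mathlib

open MeasureTheory ProbabilityTheory Filter Topology Asymptotics

noncomputable section

namespace VRIWAE

/-- The parameter space `ℝ^a × ℝ^b` of the pairs `η = (θ, φ)`. -/
abbrev Param (a b : ℕ) : Type := (Fin a → ℝ) × (Fin b → ℝ)

/-- The value at `η = (θ, φ)` of the component `ψ` of `(θ_1, …, θ_a, φ_1, …, φ_b)`. -/
def component {a b : ℕ} (ψ : Fin a ⊕ Fin b) (η : Param a b) : ℝ :=
  match ψ with
  | .inl i => η.1 i
  | .inr k => η.2 k

/-- The parameter `η = (θ, φ)` with its component `ψ` replaced by the number `t`. -/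
def replace {a b : ℕ} (ψ : Fin a ⊕ Fin b) (η : Param a b) (t : ℝ) : Param a b :=
  match ψ with
  | .inl i => (Function.update η.1 i t, η.2)
  | .inr k => (η.1, Function.update η.2 k t)

/-- The partial derivative `∂_ψ g (η)`. -/
def pderiv {a b : ℕ} (ψ : Fin a ⊕ Fin b) (g : Param a b → ℝ) (η : Param a b) : ℝ :=
  deriv (fun t => g (replace ψ η t)) (component ψ η)

/-- The partial derivative `∂_ψ g (η)` exists. -/
def PDiffAt {a b : ℕ} (ψ : Fin a ⊕ Fin b) (g : Param a b → ℝ) (η : Param a b) : Prop :=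
  DifferentiableAt ℝ (fun t => g (replace ψ η t)) (component ψ η)

/-- `V` is a `ψ`-neighbourhood of `η`. -/
def IsPsiNeighborhood {a b : ℕ} (ψ : Fin a ⊕ Fin b) (V : Set (Param a b)) (η : Param a b) : Prop :=
  ∃ r > 0, ∀ t ∈ Set.Ioo (component ψ η - r) (component ψ η + r), replace ψ η t ∈ V

/-- The data of the problem; the observation `x` is fixed and left out of the notation. -/
structure Model (a b d : ℕ) (E : Type*) [MeasurableSpace E] where
  /-- parameter set of `θ` -/
  Θ : Set (Fin a → ℝ)
  /-- parameter set of `φ` -/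
  Φ : Set (Fin b → ℝ)
  /-- dominating measure on the latent space `ℝ^d` -/
  ν : Measure (Fin d → ℝ)
  /-- `joint θ z = p_θ(x, z)` -/
  joint : (Fin a → ℝ) → (Fin d → ℝ) → ℝ
  /-- `q φ z = q_φ(z | x)` -/
  q : (Fin b → ℝ) → (Fin d → ℝ) → ℝ
  /-- law of the noise variable `ε` -/
  Q : Measure E
  /-- the reparameterization `f ε φ = f(ε, φ; x)` -/
  f : E → (Fin b → ℝ) → (Fin d → ℝ)

namespace Model

variable {a b d : ℕ} {E : Type*} [MeasurableSpace E] (S : Model a b d E)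

/-- `p_θ(x)`. -/
def marginal (θ : Fin a → ℝ) : ℝ := ∫ z, S.joint θ z ∂S.ν

/-- `p_θ(z | x)`. -/
def posterior (θ : Fin a → ℝ) (z : Fin d → ℝ) : ℝ := S.joint θ z / S.marginal θ

/-- The probability distribution on `ℝ^d` with density `q_φ(· | x)`. -/
def qLaw (φ : Fin b → ℝ) : Measure (Fin d → ℝ) :=
  S.ν.withDensity fun z => ENNReal.ofReal (S.q φ z)

/-- Standing assumptions on the model, the variational family and the reparameterization. -/
structure Standing : Prop where
  isOpen_Θ : IsOpen S.Θ
  isOpen_Φ : IsOpen S.Φ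
  sigmaFinite : SigmaFinite S.ν
  isProbability : IsProbabilityMeasure S.Q
  joint_nonneg : ∀ θ ∈ S.Θ, ∀ z, 0 ≤ S.joint θ z
  q_nonneg : ∀ φ ∈ S.Φ, ∀ z, 0 ≤ S.q φ z
  joint_integrable : ∀ θ ∈ S.Θ, Integrable (S.joint θ) S.ν
  q_integrable : ∀ φ ∈ S.Φ, Integrable (S.q φ) S.ν
  q_integral : ∀ φ ∈ S.Φ, ∫ z, S.q φ z ∂S.ν = 1
  posterior_pos : ∀ θ ∈ S.Θ, ∀ᵐ z ∂S.ν, 0 < S.posterior θ z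
  q_pos : ∀ φ ∈ S.Φ, ∀ᵐ z ∂S.ν, 0 < S.q φ z
  marginal_diff : DifferentiableOn ℝ S.marginal S.Θ
  posterior_diff : DifferentiableOn ℝ
    (fun y : (Fin d → ℝ) × (Fin a → ℝ) => S.posterior y.2 y.1) (Set.univ ×ˢ S.Θ)
  q_diff : DifferentiableOn ℝ
    (fun y : (Fin d → ℝ) × (Fin b → ℝ) => S.q y.2 y.1) (Set.univ ×ˢ S.Φ)
  f_law : ∀ φ ∈ S.Φ, HasLaw (fun ε => S.f ε φ) (S.qLaw φ) S.Q
  f_diff : ∀ᵐ ε ∂S.Q, DifferentiableOn ℝ (S.f ε) S.Φ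

/-- The importance weight `w_{θ,φ}(z; x) = p_θ(x, z) / q_φ(z | x)`, with `η = (θ, φ)`. -/
def weight (η : Param a b) (z : Fin d → ℝ) : ℝ := S.joint η.1 z / S.q η.2 z

/-- The reparameterized weight `w_{θ,φ}(f(ε, φ; x); x)`, with `η = (θ, φ)`. -/
def tw (ε : E) (η : Param a b) : ℝ := S.weight η (S.f ε η.2)

/-- The VR bound. -/
def VR (α : ℝ) (η : Param a b) : ℝ :=
  1 / (1 - α) * Real.log (∫ z, S.weight η z ^ (1 - α) ∂S.qLaw η.2)

/-- The quantity `γ_α²`. -/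
def gammaSq (α : ℝ) (η : Param a b) : ℝ :=
  1 / (1 - α) * Var[fun z => S.weight η z ^ (1 - α) /
    ∫ z', S.weight η z' ^ (1 - α) ∂S.qLaw η.2; S.qLaw η.2]

/-- The normalized weight `w̃^{1-α} / 𝔼(w̃^{1-α})` as a function of `ε` and `η`. -/
def normalizedWeight (α : ℝ) (ε : E) (η : Param a b) : ℝ :=
  S.tw ε η ^ (1 - α) / ∫ ε', S.tw ε' η ^ (1 - α) ∂S.Q

/-- The asymptotic variance `v_REP`. -/
def vREP (α : ℝ) (ψ : Fin a ⊕ Fin b) (η : Param a b) : ℝ :=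
  1 / (1 - α) ^ 2 * Var[fun ε => pderiv ψ (S.normalizedWeight α ε) η; S.Q]

/-- The REP gradient estimator with respect to `ψ`, for the noise samples
`ε m j`, `m < M`, `j < N`. -/
def gradREP (α : ℝ) (ψ : Fin a ⊕ Fin b) (η : Param a b) (M N : ℕ) (ε : ℕ → ℕ → E) : ℝ :=
  1 / (M : ℝ) * ∑ m ∈ Finset.range M, ∑ j ∈ Finset.range N,
    S.tw (ε m j) η ^ (1 - α) / (∑ l ∈ Finset.range N, S.tw (ε m l) η ^ (1 - α)) *
      pderiv ψ (fun η' => Real.log (S.tw (ε m j) η')) η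

/-- Negative moment condition: `𝔼(|N⁻¹ ∑ w̃_j^{1-α}|^{-μ}) < ∞` for some `μ > 1`, `N ≥ 1`. -/
def NegativeMoment (α : ℝ) (η : Param a b) : Prop :=
  ∃ μ : ℝ, 1 < μ ∧ ∃ N : ℕ, 1 ≤ N ∧
    ∫⁻ e : Fin N → E, ENNReal.ofReal
      (|(N : ℝ)⁻¹ * ∑ j, S.tw (e j) η ^ (1 - α)| ^ (-μ)) ∂(Measure.pi fun _ => S.Q) < ⊤

/-- Weight moment condition of order `h`. -/
def WeightMoment (α h : ℝ) (η : Param a b) : Prop :=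
  ∫⁻ ε, ENNReal.ofReal (S.tw ε η ^ ((1 - α) * h)) ∂S.Q < ⊤

/-- Derivative moment condition of order `h'`. -/
def DerivMoment (α h' : ℝ) (ψ : Fin a ⊕ Fin b) (η : Param a b) : Prop :=
  ∫⁻ ε, ENNReal.ofReal (|pderiv ψ (fun η' => S.tw ε η' ^ (1 - α)) η| ^ h') ∂S.Q < ⊤

/-- Domination condition. The first conjunct after `V ⊆ Θ × Φ` says that, almost surely, `log w̃` is
well defined on `V`, so that the supremum makes sense. -/
def Domination (α : ℝ) (ψ : Fin a ⊕ Fin b) : Prop :=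
  ∀ η ∈ S.Θ ×ˢ S.Φ, ∃ V : Set (Param a b), IsPsiNeighborhood ψ V η ∧ V ⊆ S.Θ ×ˢ S.Φ ∧
    (∀ᵐ ε ∂S.Q, ∀ η' ∈ V, 0 < S.joint η'.1 (S.f ε η'.2) ∧ 0 < S.q η'.2 (S.f ε η'.2)) ∧
    ∀ l ∈ ({0, 1, 2} : Set ℝ),
      ∫⁻ ε, (⨆ η' ∈ V, ENNReal.ofReal
        |S.tw ε η' ^ (l * (1 - α)) * pderiv ψ (fun η'' => Real.log (S.tw ε η'')) η'|) ∂S.Q < ⊤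

end Model

/-- The signal-to-noise ratio `|𝔼 X| / √(𝕍 X)`. -/
def SNR {Ω : Type*} [MeasurableSpace Ω] (X : Ω → ℝ) (P : Measure Ω) : ℝ :=
  |∫ ω, X ω ∂P| / √(Var[X; P])

end VRIWAE

end

set_option linter.unusedSectionVars false

noncomputable section

/-! Write `X` for `w̃^{1-α}`, `Y` for its `ψ`-derivative, `m = 𝔼 X`, `c = 𝔼 Y / m` and `u = Y - c
X`, which is centred. Since `X ∂_ψ log w̃ = Y / (1-α)`, one block of the estimator equals `(c + R_N)
/ (1-α)` with `R_N = ∑ u / ∑ X`. Here `c / (1-α) = ∂_ψ VR`, while `∂_ψ γ² = 2 𝔼(uX) / ((1-α) m²)`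
and `v_REP = 𝔼(u²) / ((1-α)² m²)`. The theorem therefore reduces to `N 𝔼 R_N → -𝔼(uX)/m²` and `N 𝕍
R_N → 𝔼(u²)/m²`. Averaging `M` independent blocks keeps the mean and divides the variance by `M`, so
the remainders do not depend on `M`.

The two limits (`tendsto_mul_integral_ratio`, `tendsto_mul_variance_ratio`) come from an exact
leave-one-out expansion. By exchangeability only the last summand matters. With `T` the sum of the
other `n` weights, `s = x/(x+T)` and `A = n/T`, one has `1/(x+T) = (A/n)(1-s)`. The variable `A` is
independent of the last pair, so centring removes the leading terms, and `s` is negligible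
(`tendsto_share_zero`).

The required moments of `A` come from the negative moment condition. Multiplying inverses of
independent block sums makes inverse moments of every order finite, and convexity makes them
nonincreasing in the sample size (`exists_invMean_bound`). An `L²` law of large numbers then gives
`𝔼 A² → m⁻²`.

The derivatives of the moments of `X` are computed under the integral sign by
`hasDerivAt_integral_of_lintegral_iSup_deriv`. -/

namespace VRIWAE

/-! ### I.i.d. pairs: exchangeability and uniform inverse moments. -/

section Ratio

variable {Ω : Type*} [MeasurableSpace Ω] {P : Measure Ω}

/-- The sum of the random vectors `Z j`, `j ∈ s`. -/
def partialSum {V : Type*} [AddCommMonoid V] (Z : ℕ → Ω → V) (s : Finset ℕ) (ω : Ω) : V :=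
  ∑ j ∈ s, Z j ω

/-- An i.i.d. sequence of square integrable pairs with positive first and centred second component,
the sum of finitely many first components having an integrable inverse. -/
structure IsRatioSequence (Z : ℕ → Ω → ℝ × ℝ) (P : Measure Ω) : Prop where
  isProbability : IsProbabilityMeasure P
  meas : ∀ j, Measurable (Z j)
  indep : iIndepFun Z P
  ident : ∀ j, IdentDistrib (Z j) (Z 0) P P
  pos : ∀ j ω, 0 < (Z j ω).1
  memLp_fst : MemLp (fun ω => (Z 0 ω).1) 2 P
  memLp_snd : MemLp (fun ω => (Z 0 ω).2) 2 P
  integral_snd : ∫ ω, (Z 0 ω).2 ∂P = 0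
  inv_integrable : ∃ n : ℕ, 1 ≤ n ∧
    Integrable (fun ω => (partialSum Z (Finset.range n) ω).1⁻¹) P

lemma integrable_mul_of_indepFun {f g : Ω → ℝ} (hfg : IndepFun f g P) (hf : Integrable f P)
    (hg : Integrable g P) :
    Integrable (fun ω => f ω * g ω) P := hfg.integrable_mul hf hg

/-- Weighted arithmetic-geometric mean inequality. The free weight `c` serves to balance a small
factor against a bounded one. -/
lemma integral_abs_mul_le {f g : Ω → ℝ} (hf : MemLp f 2 P) (hg : MemLp g 2 P) {c : ℝ}
    (hc : 0 < c) :
    ∫ ω, |f ω * g ω| ∂P ≤ (c * ∫ ω, f ω ^ 2 ∂P + c⁻¹ * ∫ ω, g ω ^ 2 ∂P) / 2 := by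
  have h1 := hf.integrable_sq
  have h2 := hg.integrable_sq
  have key : ∀ ω, |f ω * g ω| ≤ (c * f ω ^ 2 + c⁻¹ * g ω ^ 2) / 2 := by
    intro ω
    have hc2 : 0 ≤ c⁻¹ * (c * |f ω| - |g ω|) ^ 2 := by positivity
    have : c⁻¹ * (c * |f ω| - |g ω|) ^ 2 = c * f ω ^ 2 - 2 * |f ω * g ω| + c⁻¹ * g ω ^ 2 := by
      rw [abs_mul, ← sq_abs (f ω), ← sq_abs (g ω)]
      field_simp
      ring
    linarith
  calc ∫ ω, |f ω * g ω| ∂P ≤ ∫ ω, (c * f ω ^ 2 + c⁻¹ * g ω ^ 2) / 2 ∂P :=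
        integral_mono (hf.integrable_mul hg).abs
          (((h1.const_mul c).add (h2.const_mul c⁻¹)).div_const 2) key
    _ = _ := by
        rw [integral_div, integral_add (h1.const_mul c) (h2.const_mul c⁻¹),
          integral_const_mul, integral_const_mul]

lemma measurable_partialSum {Z : ℕ → Ω → ℝ × ℝ} (hZ : ∀ j, Measurable (Z j)) (s : Finset ℕ) :
    Measurable (partialSum Z s) :=
  Finset.measurable_fun_sum s fun j _ => hZ j

namespace IsRatioSequence

variable {Z : ℕ → Ω → ℝ × ℝ}

lemma indep_single (h : IsRatioSequence Z P) {s : Finset ℕ} {i : ℕ} (hi : i ∉ s) :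
    IndepFun (Z i) (partialSum Z s) P := by
  have := (h.indep.indepFun_finsetSum_of_notMem h.meas hi).symm
  convert this using 1
  ext1 ω; simp [partialSum]

lemma indep_disjoint (h : IsRatioSequence Z P) {s t : Finset ℕ} (hst : Disjoint s t) :
    IndepFun (partialSum Z s) (partialSum Z t) P := by
  have key := h.indep.indepFun_finset s t hst h.meas
  have hm : ∀ u : Finset ℕ, Measurable (fun x : u → ℝ × ℝ => ∑ j, x j) := fun u => by fun_prop
  have := key.comp (hm s) (hm t)
  convert this using 1
  · ext1 ω; simp only [partialSum, Function.comp]; exact (Finset.sum_coe_sort s fun j => Z j ω).symm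
  · ext1 ω; simp only [partialSum, Function.comp]; exact (Finset.sum_coe_sort t fun j => Z j ω).symm

lemma partialSum_insert {s : Finset ℕ} {i : ℕ} (hi : i ∉ s) :
    partialSum Z (insert i s) = Z i + partialSum Z s := by
  ext1 ω; simp [partialSum, Finset.sum_insert hi]

/-- By independence the law of the sum is a convolution power of the common law, so only the
cardinality of the index set counts. -/
lemma map_partialSum_eq (h : IsRatioSequence Z P) (s : Finset ℕ) :
    ∀ t : Finset ℕ, t.card = s.card → P.map (partialSum Z s) = P.map (partialSum Z t) := by
  have := h.isProbability
  induction s using Finset.induction_on with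
  | empty =>
    intro t ht
    rw [Finset.card_empty, Finset.card_eq_zero] at ht
    rw [ht]
  | insert i s hi ih =>
    intro t ht
    rw [Finset.card_insert_of_notMem hi, Finset.card_eq_succ] at ht
    obtain ⟨j, t', hj, rfl, ht'⟩ := ht
    rw [partialSum_insert hi, partialSum_insert hj,
      (h.indep_single hi).map_add_eq_map_conv_map (h.meas i) (measurable_partialSum h.meas s),
      (h.indep_single hj).map_add_eq_map_conv_map (h.meas j) (measurable_partialSum h.meas t'),
      ih t' ht', (h.ident i).map_eq, (h.ident j).map_eq]

lemma identDistrib_partialSum (h : IsRatioSequence Z P) {s t : Finset ℕ} (hst : t.card = s.card) :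
    IdentDistrib (partialSum Z s) (partialSum Z t) P P :=
  ⟨(measurable_partialSum h.meas s).aemeasurable, (measurable_partialSum h.meas t).aemeasurable,
    h.map_partialSum_eq s t hst⟩

/-- Both joint laws are the product of the law of one pair and that of a sum of equally many others.
This is the source of exchangeability. -/
lemma identDistrib_pair (h : IsRatioSequence Z P) {s t : Finset ℕ} {i j : ℕ} (hi : i ∉ s)
    (hj : j ∉ t) (hst : t.card = s.card) :
    IdentDistrib (fun ω => (Z i ω, partialSum Z s ω)) (fun ω => (Z j ω, partialSum Z t ω)) P P := by
  have := h.isProbability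
  refine ⟨((h.meas i).prodMk (measurable_partialSum h.meas s)).aemeasurable,
    ((h.meas j).prodMk (measurable_partialSum h.meas t)).aemeasurable, ?_⟩
  rw [(indepFun_iff_map_prod_eq_prod_map_map (h.meas i).aemeasurable
      (measurable_partialSum h.meas s).aemeasurable).1 (h.indep_single hi),
    (indepFun_iff_map_prod_eq_prod_map_map (h.meas j).aemeasurable
      (measurable_partialSum h.meas t).aemeasurable).1 (h.indep_single hj),
    h.map_partialSum_eq s t hst, (h.ident i).map_eq, (h.ident j).map_eq]

lemma fst_partialSum (s : Finset ℕ) (ω : Ω) :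
    (partialSum Z s ω).1 = ∑ j ∈ s, (Z j ω).1 := by
  simp [partialSum, Prod.fst_sum]

lemma snd_partialSum (s : Finset ℕ) (ω : Ω) :
    (partialSum Z s ω).2 = ∑ j ∈ s, (Z j ω).2 := by
  simp [partialSum, Prod.snd_sum]

lemma fst_partialSum_nonneg (h : IsRatioSequence Z P) (s : Finset ℕ) (ω : Ω) :
    0 ≤ (partialSum Z s ω).1 := by
  rw [fst_partialSum]; exact Finset.sum_nonneg fun j _ => (h.pos j ω).le

lemma fst_partialSum_pos (h : IsRatioSequence Z P) {s : Finset ℕ} (hs : s.Nonempty) (ω : Ω) :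
    0 < (partialSum Z s ω).1 := by
  rw [fst_partialSum]; exact Finset.sum_pos (fun j _ => h.pos j ω) hs

lemma partialSum_union {s t : Finset ℕ} (hst : Disjoint s t) (ω : Ω) :
    partialSum Z (s ∪ t) ω = partialSum Z s ω + partialSum Z t ω := by
  simp [partialSum, Finset.sum_union hst]

/-- For disjoint blocks with sums `a`, `b`, positivity gives `(a+b)^{-(k+1)} ≤ a^{-k} b^{-1}`, and
the right side is integrable by independence. Each further order costs one more block of the size
given by `inv_integrable`. -/
lemma exists_integrable_inv_pow (h : IsRatioSequence Z P) (k : ℕ) :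
    ∃ n : ℕ, 1 ≤ n ∧ Integrable (fun ω => (partialSum Z (Finset.range n) ω).1⁻¹ ^ k) P := by
  have := h.isProbability
  induction k with
  | zero => exact ⟨1, le_rfl, by simp⟩
  | succ k ih =>
    obtain ⟨n, hn, hint⟩ := ih
    obtain ⟨l, hl, hint'⟩ := h.inv_integrable
    refine ⟨n + l, by omega, ?_⟩
    have hdisj : Disjoint (Finset.range n) (Finset.Ico n (n + l)) := by
      rw [Finset.range_eq_Ico]; exact Finset.Ico_disjoint_Ico_consecutive 0 n (n + l)
    have hunion : Finset.range (n + l) = Finset.range n ∪ Finset.Ico n (n + l) := by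
      rw [Finset.range_eq_Ico, Finset.range_eq_Ico,
        Finset.Ico_union_Ico_eq_Ico (Nat.zero_le n) (Nat.le_add_right n l)]
    have hid := h.identDistrib_partialSum (s := Finset.range l) (t := Finset.Ico n (n + l))
      (by simp)
    have hint2 : Integrable (fun ω => (partialSum Z (Finset.Ico n (n + l)) ω).1⁻¹) P :=
      ((hid.comp (u := fun z : ℝ × ℝ => z.1⁻¹) (by fun_prop)).integrable_iff).1 hint'
    have hprod := integrable_mul_of_indepFun
      ((h.indep_disjoint hdisj).comp (φ := fun z : ℝ × ℝ => z.1⁻¹ ^ k) (ψ := fun z : ℝ × ℝ => z.1⁻¹)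
        (by fun_prop) (by fun_prop)) hint hint2
    refine hprod.mono' ?_ (ae_of_all _ fun ω => ?_)
    · exact (((measurable_partialSum h.meas _).fst.inv).pow_const _).aestronglyMeasurable
    · have p1 := h.fst_partialSum_pos (s := Finset.range n) (by simp; omega) ω
      have p2 := h.fst_partialSum_pos (s := Finset.Ico n (n + l)) (by simp; omega) ω
      rw [hunion, partialSum_union hdisj, Prod.fst_add, Real.norm_of_nonneg (by positivity),
        pow_succ]
      simp only [Function.comp]
      gcongr
      · linarith
      · linarith

/-- The inverse of the mean of the first `n` weights. -/
def invMean (Z : ℕ → Ω → ℝ × ℝ) (n : ℕ) (ω : Ω) : ℝ :=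
  n * (partialSum Z (Finset.range n) ω).1⁻¹

lemma measurable_invMean (h : IsRatioSequence Z P) (n : ℕ) : Measurable (invMean Z n) :=
  ((measurable_partialSum h.meas _).fst.inv).const_mul _

lemma invMean_nonneg (h : IsRatioSequence Z P) (n : ℕ) (ω : Ω) : 0 ≤ invMean Z n ω :=
  mul_nonneg (Nat.cast_nonneg n) (inv_nonneg.2 (h.fst_partialSum_nonneg _ ω))

/-- Convexity: the power of the inverse mean is at most the average of its leave-one-out
versions. -/
lemma invMean_pow_succ_le (h : IsRatioSequence Z P) {n : ℕ} (hn : 1 ≤ n) (k : ℕ) (ω : Ω) :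
    invMean Z (n + 1) ω ^ k ≤ ∑ j ∈ Finset.range (n + 1), ((n : ℝ) + 1)⁻¹ *
      (n * (partialSum Z ((Finset.range (n + 1)).erase j) ω).1⁻¹) ^ k := by
  have hn0 : (0 : ℝ) < n := by exact_mod_cast hn
  have hpos : ∀ j ∈ Finset.range (n + 1),
      0 < (partialSum Z ((Finset.range (n + 1)).erase j) ω).1 := fun j hj =>
    h.fst_partialSum_pos (by
      rw [← Finset.card_pos, Finset.card_erase_of_mem hj, Finset.card_range]; omega) ω
  -- Jensen for `y ↦ y^{-k}` at the leave-one-out means with equal weights. Their average is the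
  -- full mean, because each weight is omitted exactly once.
  have hconv := (convexOn_zpow (𝕜 := ℝ) (-(k : ℤ))).map_sum_le (t := Finset.range (n + 1))
    (w := fun _ => ((n : ℝ) + 1)⁻¹)
    (p := fun j => (partialSum Z ((Finset.range (n + 1)).erase j) ω).1 / n)
    (fun _ _ => by positivity)
    (by simp; field_simp)
    (fun j hj => div_pos (hpos j hj) hn0)
  have hsum : ∑ j ∈ Finset.range (n + 1),
      (partialSum Z ((Finset.range (n + 1)).erase j) ω).1 =
      n * (partialSum Z (Finset.range (n + 1)) ω).1 := by
    have : ∀ j ∈ Finset.range (n + 1), (partialSum Z ((Finset.range (n + 1)).erase j) ω).1 =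
        (partialSum Z (Finset.range (n + 1)) ω).1 - (Z j ω).1 := by
      intro j hj
      rw [fst_partialSum, fst_partialSum, ← Finset.add_sum_erase _ _ hj]; ring
    rw [Finset.sum_congr rfl this, Finset.sum_sub_distrib,
      ← fst_partialSum (Z := Z) (Finset.range (n + 1)) ω, Finset.sum_const,
      Finset.card_range, nsmul_eq_mul]
    push_cast
    ring
  have e1 : ∑ j ∈ Finset.range (n + 1), ((n : ℝ) + 1)⁻¹ •
      ((partialSum Z ((Finset.range (n + 1)).erase j) ω).1 / n) =
      (invMean Z (n + 1) ω)⁻¹ := by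
    simp_rw [smul_eq_mul]
    rw [← Finset.mul_sum, ← Finset.sum_div, hsum, invMean]
    push_cast
    rw [mul_inv, inv_inv]
    field_simp
  rw [e1] at hconv
  simp only [smul_eq_mul, zpow_neg, zpow_natCast, inv_pow, inv_inv] at hconv
  refine hconv.trans_eq (Finset.sum_congr rfl fun j _ => ?_)
  rw [← inv_pow, inv_div, div_eq_mul_inv]

lemma identDistrib_erase (h : IsRatioSequence Z P) {n j : ℕ} (hj : j ∈ Finset.range (n + 1)) :
    IdentDistrib (fun ω => (Z j ω, partialSum Z ((Finset.range (n + 1)).erase j) ω))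
      (fun ω => (Z n ω, partialSum Z (Finset.range n) ω)) P P :=
  h.identDistrib_pair (Finset.notMem_erase j _) (by simp) (by
    rw [Finset.card_erase_of_mem hj]; simp)

lemma integrable_invMean_succ (h : IsRatioSequence Z P) {n : ℕ} (hn : 1 ≤ n) {k : ℕ}
    (hint : Integrable (fun ω => invMean Z n ω ^ k) P) :
    Integrable (fun ω => invMean Z (n + 1) ω ^ k) P ∧
      ∫ ω, invMean Z (n + 1) ω ^ k ∂P ≤ ∫ ω, invMean Z n ω ^ k ∂P := by
  have hid : ∀ j ∈ Finset.range (n + 1),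
      IdentDistrib (fun ω => (n * (partialSum Z ((Finset.range (n + 1)).erase j) ω).1⁻¹) ^ k)
        (fun ω => invMean Z n ω ^ k) P P := fun j hj =>
    (h.identDistrib_erase hj).comp (u := fun z : (ℝ × ℝ) × (ℝ × ℝ) => ((n : ℝ) * z.2.1⁻¹) ^ k)
      (by fun_prop)
  have hsum : Integrable (fun ω => ∑ j ∈ Finset.range (n + 1), ((n : ℝ) + 1)⁻¹ *
      (n * (partialSum Z ((Finset.range (n + 1)).erase j) ω).1⁻¹) ^ k) P :=
    integrable_finsetSum _ fun j hj => ((hid j hj).integrable_iff.2 hint).const_mul _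
  have hi : Integrable (fun ω => invMean Z (n + 1) ω ^ k) P := by
    refine hsum.mono' ((h.measurable_invMean _).pow_const k).aestronglyMeasurable
      (ae_of_all _ fun ω => ?_)
    rw [Real.norm_of_nonneg (pow_nonneg (h.invMean_nonneg _ ω) k)]
    exact h.invMean_pow_succ_le hn k ω
  refine ⟨hi, (integral_mono hi hsum fun ω => h.invMean_pow_succ_le hn k ω).trans_eq ?_⟩
  rw [integral_finsetSum _ fun j hj => ((hid j hj).integrable_iff.2 hint).const_mul _]
  rw [Finset.sum_congr rfl fun j hj => by rw [integral_const_mul, (hid j hj).integral_eq]]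
  simp
  field_simp

/-- Once finite, the `k`-th moment does not increase with the sample size, so its value at the first
admissible size `n₀` serves as the bound. -/
lemma exists_invMean_bound (h : IsRatioSequence Z P) (k : ℕ) :
    ∃ C : ℝ, 0 ≤ C ∧ ∀ᶠ n : ℕ in atTop, Integrable (fun ω => invMean Z n ω ^ k) P ∧
      ∫ ω, invMean Z n ω ^ k ∂P ≤ C := by
  obtain ⟨n₀, hn₀, hint⟩ := h.exists_integrable_inv_pow k
  have hint' : Integrable (fun ω => invMean Z n₀ ω ^ k) P := by
    simpa only [invMean, mul_pow] using hint.const_mul ((n₀ : ℝ) ^ k)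
  refine ⟨∫ ω, invMean Z n₀ ω ^ k ∂P, integral_nonneg fun ω =>
    pow_nonneg (h.invMean_nonneg _ ω) k, ?_⟩
  filter_upwards [eventually_ge_atTop n₀] with n hn
  induction n, hn using Nat.le_induction with
  | base => exact ⟨hint', le_rfl⟩
  | succ n hn ih =>
    have := h.integrable_invMean_succ (hn₀.trans hn) ih.1
    exact ⟨this.1, this.2.trans ih.2⟩

end IsRatioSequence

end Ratio

/-! ### Asymptotic bias and variance of a ratio of sums. -/

section RatioLimits

variable {Ω : Type*} [MeasurableSpace Ω] {P : Measure Ω}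

/-- A factor of size `n^{-1/2}` in `L²` times one bounded in `L²`. The weight `√n` in
`integral_abs_mul_le` makes both halves `O(n^{-1/2})`. -/
lemma tendsto_integral_abs_mul_zero {f g : ℕ → Ω → ℝ} {K C : ℝ}
    (hf : ∀ᶠ n : ℕ in atTop, MemLp (f n) 2 P ∧ ∫ ω, f n ω ^ 2 ∂P ≤ K / n)
    (hg : ∀ᶠ n : ℕ in atTop, MemLp (g n) 2 P ∧ ∫ ω, g n ω ^ 2 ∂P ≤ C) :
    Tendsto (fun n => ∫ ω, |f n ω * g n ω| ∂P) atTop (𝓝 0) := by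
  have hlim : Tendsto (fun n : ℕ => (K + C) / 2 * (√(n : ℝ))⁻¹) atTop (𝓝 0) := by
    simpa using ((tendsto_inv_atTop_zero.comp
      (Real.tendsto_sqrt_atTop.comp tendsto_natCast_atTop_atTop)).const_mul ((K + C) / 2))
  refine squeeze_zero' (Eventually.of_forall fun n => integral_nonneg fun ω => abs_nonneg _) ?_ hlim
  filter_upwards [hf, hg, eventually_ge_atTop 1] with n hfn hgn hn
  have hn0 : (0 : ℝ) < n := by exact_mod_cast hn
  have hs : 0 < √(n : ℝ) := Real.sqrt_pos.2 hn0
  refine (integral_abs_mul_le hfn.1 hgn.1 hs).trans ?_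
  have h1 : √(n : ℝ) * ∫ ω, f n ω ^ 2 ∂P ≤ K * (√(n : ℝ))⁻¹ := by
    calc √(n : ℝ) * ∫ ω, f n ω ^ 2 ∂P ≤ √(n : ℝ) * (K / n) := by gcongr; exact hfn.2
      _ = K * (√(n : ℝ))⁻¹ := by
        nth_rewrite 2 [← Real.mul_self_sqrt hn0.le]
        field_simp
  have h2 : (√(n : ℝ))⁻¹ * ∫ ω, g n ω ^ 2 ∂P ≤ (√(n : ℝ))⁻¹ * C := by gcongr; exact hgn.2
  linarith

namespace IsRatioSequence

variable {Z : ℕ → Ω → ℝ × ℝ}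

/-- The share of the last of `n + 1` weights. -/
def lastShare (Z : ℕ → Ω → ℝ × ℝ) (n : ℕ) (ω : Ω) : ℝ :=
  (Z n ω).1 / ((Z n ω).1 + (partialSum Z (Finset.range n) ω).1)

/-- The ratio of the sums of the two components. -/
def ratio (Z : ℕ → Ω → ℝ × ℝ) (n : ℕ) (ω : Ω) : ℝ :=
  (partialSum Z (Finset.range n) ω).2 / (partialSum Z (Finset.range n) ω).1

lemma measurable_lastShare (h : IsRatioSequence Z P) (n : ℕ) : Measurable (lastShare Z n) :=
  (h.meas n).fst.div ((h.meas n).fst.add (measurable_partialSum h.meas _).fst)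

lemma lastShare_nonneg (h : IsRatioSequence Z P) (n : ℕ) (ω : Ω) : 0 ≤ lastShare Z n ω :=
  div_nonneg (h.pos n ω).le (add_nonneg (h.pos n ω).le (h.fst_partialSum_nonneg _ ω))

lemma lastShare_le_one (h : IsRatioSequence Z P) (n : ℕ) (ω : Ω) : lastShare Z n ω ≤ 1 :=
  div_le_one_of_le₀ (le_add_of_nonneg_right (h.fst_partialSum_nonneg _ ω))
    (add_nonneg (h.pos n ω).le (h.fst_partialSum_nonneg _ ω))

lemma lastShare_le (h : IsRatioSequence Z P) {n : ℕ} (hn : 1 ≤ n) (ω : Ω) :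
    lastShare Z n ω ≤ (Z n ω).1 * invMean Z n ω / n := by
  have hT := h.fst_partialSum_pos (s := Finset.range n) (by simp; omega) ω
  have hx := h.pos n ω
  have hn0 : (0 : ℝ) < n := by exact_mod_cast hn
  have : (Z n ω).1 * invMean Z n ω / n = (Z n ω).1 / (partialSum Z (Finset.range n) ω).1 := by
    rw [invMean]; field_simp
  rw [this, lastShare]
  gcongr
  linarith

/-- An exact identity in place of a Taylor expansion: the factor `invMean` is independent of the
last pair, and all dependence sits in the share. -/
lemma inv_add_eq (h : IsRatioSequence Z P) {n : ℕ} (hn : 1 ≤ n) (ω : Ω) :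
    ((Z n ω).1 + (partialSum Z (Finset.range n) ω).1)⁻¹ =
      invMean Z n ω / n * (1 - lastShare Z n ω) := by
  have hT := h.fst_partialSum_pos (s := Finset.range n) (by simp; omega) ω
  have hx := h.pos n ω
  have hn0 : (0 : ℝ) < n := by exact_mod_cast hn
  rw [invMean, lastShare]
  field_simp
  ring

lemma indep_last (h : IsRatioSequence Z P) (n : ℕ) {f g : ℝ × ℝ → ℝ} (hf : Measurable f)
    (hg : Measurable g) :
    IndepFun (fun ω => f (Z n ω)) (fun ω => g (partialSum Z (Finset.range n) ω)) P :=
  (h.indep_single (i := n) (s := Finset.range n) (by simp)).comp hf hg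

lemma integral_last (h : IsRatioSequence Z P) (n : ℕ) {f : ℝ × ℝ → ℝ} (hf : Measurable f) :
    ∫ ω, f (Z n ω) ∂P = ∫ ω, f (Z 0 ω) ∂P :=
  ((h.ident n).comp hf).integral_eq

lemma integrable_last (h : IsRatioSequence Z P) (n : ℕ) {f : ℝ × ℝ → ℝ} (hf : Measurable f)
    (hint : Integrable (fun ω => f (Z 0 ω)) P) : Integrable (fun ω => f (Z n ω)) P :=
  ((h.ident n).comp hf).integrable_iff.2 hint

lemma integrable_last_mul (h : IsRatioSequence Z P) (n : ℕ) {f g : ℝ × ℝ → ℝ} (hf : Measurable f)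
    (hg : Measurable g) (hint : Integrable (fun ω => f (Z 0 ω)) P)
    (hint' : Integrable (fun ω => g (partialSum Z (Finset.range n) ω)) P) :
    Integrable (fun ω => f (Z n ω) * g (partialSum Z (Finset.range n) ω)) P :=
  integrable_mul_of_indepFun (h.indep_last n hf hg) (h.integrable_last n hf hint) hint'

lemma integral_last_mul (h : IsRatioSequence Z P) (n : ℕ) {f g : ℝ × ℝ → ℝ} (hf : Measurable f)
    (hg : Measurable g) :
    ∫ ω, f (Z n ω) * g (partialSum Z (Finset.range n) ω) ∂P =
      (∫ ω, f (Z 0 ω) ∂P) * ∫ ω, g (partialSum Z (Finset.range n) ω) ∂P := by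
  rw [← h.integral_last n hf]
  exact (h.indep_last n hf hg).integral_fun_mul_eq_mul_integral
    (hf.comp (h.meas n)).aestronglyMeasurable
    (hg.comp (measurable_partialSum h.meas _)).aestronglyMeasurable

lemma measurable_inv_pow (n k : ℕ) :
    Measurable (fun z : ℝ × ℝ => ((n : ℝ) * z.1⁻¹) ^ k) := by fun_prop

lemma integrable_share (h : IsRatioSequence Z P) {n k : ℕ} {g : ℝ × ℝ → ℝ} (hg : Measurable g)
    (hint : Integrable (fun ω => g (Z 0 ω)) P)
    (hA : Integrable (fun ω => invMean Z n ω ^ k) P) :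
    Integrable (fun ω => g (Z n ω) * invMean Z n ω ^ k * lastShare Z n ω) P := by
  have hprod := h.integrable_last_mul n hg (measurable_inv_pow n k) hint hA
  refine hprod.mono
    (hprod.aestronglyMeasurable.mul (h.measurable_lastShare n).aestronglyMeasurable)
    (ae_of_all _ fun ω => ?_)
  rw [norm_mul]
  refine mul_le_of_le_one_right (norm_nonneg _) ?_
  rw [Real.norm_of_nonneg (h.lastShare_nonneg n ω)]
  exact h.lastShare_le_one n ω

/-- The share of a single weight is asymptotically negligible. -/
lemma tendsto_share_zero (h : IsRatioSequence Z P) (k : ℕ) {g : ℝ × ℝ → ℝ} (hg : Measurable g)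
    (hint : Integrable (fun ω => g (Z 0 ω)) P) :
    Tendsto (fun n => ∫ ω, |g (Z n ω) * invMean Z n ω ^ k * lastShare Z n ω| ∂P) atTop (𝓝 0) := by
  obtain ⟨C, hC, hCn⟩ := h.exists_invMean_bound k
  obtain ⟨C', hC', hCn'⟩ := h.exists_invMean_bound (k + 1)
  -- Truncation at `√n`. For larger weights the share is bounded by one and the tail of `g` vanishes
  -- by dominated convergence; for smaller ones the share is at most `invMean / √n`, at the price of
  -- one more inverse moment.
  set tail : ℕ → ℝ × ℝ → ℝ := fun n z => if √(n : ℝ) < z.1 then |g z| else 0 with htail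
  have mtail : ∀ n, Measurable (tail n) := fun n =>
    Measurable.ite (measurableSet_lt measurable_const measurable_fst) hg.abs measurable_const
  have itail : ∀ n, Integrable (fun ω => tail n (Z 0 ω)) P := fun n =>
    hint.mono ((mtail n).comp (h.meas 0)).aestronglyMeasurable (ae_of_all _ fun ω => by
      simp only [htail]; split_ifs <;> simp)
  have ltail : Tendsto (fun n => ∫ ω, tail n (Z 0 ω) ∂P) atTop (𝓝 0) := by
    have : Tendsto (fun n => ∫ ω, tail n (Z 0 ω) ∂P) atTop (𝓝 (∫ _, (0 : ℝ) ∂P)) := by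
      refine tendsto_integral_of_dominated_convergence (fun ω => |g (Z 0 ω)|)
        (fun n => (itail n).aestronglyMeasurable) hint.abs
        (fun n => ae_of_all _ fun ω => ?_) (ae_of_all _ fun ω => ?_)
      · simp only [htail]; split_ifs <;> simp
      · refine tendsto_const_nhds.congr' ?_
        filter_upwards [(Real.tendsto_sqrt_atTop.comp
          tendsto_natCast_atTop_atTop).eventually_ge_atTop ((Z 0 ω).1)] with n hn
        exact (if_neg (not_lt.2 hn)).symm
    simpa using this
  have lsqrt : Tendsto (fun n : ℕ => (√(n : ℝ))⁻¹) atTop (𝓝 0) :=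
    tendsto_inv_atTop_zero.comp (Real.tendsto_sqrt_atTop.comp tendsto_natCast_atTop_atTop)
  have hlim : Tendsto (fun n : ℕ => (∫ ω, tail n (Z 0 ω) ∂P) * C +
      (√(n : ℝ))⁻¹ * ((∫ ω, |g (Z 0 ω)| ∂P) * C')) atTop (𝓝 0) := by
    simpa using (ltail.mul_const C).add (lsqrt.mul_const ((∫ ω, |g (Z 0 ω)| ∂P) * C'))
  refine squeeze_zero' (Eventually.of_forall fun n => integral_nonneg fun ω => abs_nonneg _) ?_ hlim
  filter_upwards [hCn, hCn', eventually_ge_atTop 1] with n hn hn' hn1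
  have hn0 : (0 : ℝ) < n := by exact_mod_cast hn1
  have i1 : Integrable (fun ω => tail n (Z n ω) * invMean Z n ω ^ k) P :=
    h.integrable_last_mul n (mtail n) (measurable_inv_pow n k) (itail n) hn.1
  have i2 : Integrable (fun ω => |g (Z n ω)| * invMean Z n ω ^ (k + 1)) P :=
    h.integrable_last_mul n hg.abs (measurable_inv_pow n (k + 1)) hint.abs hn'.1
  calc ∫ ω, |g (Z n ω) * invMean Z n ω ^ k * lastShare Z n ω| ∂P
      ≤ ∫ ω, (tail n (Z n ω) * invMean Z n ω ^ k +
          (√(n : ℝ))⁻¹ * (|g (Z n ω)| * invMean Z n ω ^ (k + 1))) ∂P := by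
        refine integral_mono (h.integrable_share hg hint hn.1).abs (i1.add (i2.const_mul _))
          fun ω => ?_
        have hA := h.invMean_nonneg n ω
        have hs := h.lastShare_nonneg n ω
        simp only [abs_mul, abs_of_nonneg hs, abs_of_nonneg (pow_nonneg hA k), htail]
        split_ifs with hlt
        · have : |g (Z n ω)| * invMean Z n ω ^ k * lastShare Z n ω ≤
              |g (Z n ω)| * invMean Z n ω ^ k :=
            mul_le_of_le_one_right (by positivity) (h.lastShare_le_one n ω)
          have : 0 ≤ (√(n : ℝ))⁻¹ * (|g (Z n ω)| * invMean Z n ω ^ (k + 1)) := by positivity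
          linarith
        · have hle : lastShare Z n ω ≤ (√(n : ℝ))⁻¹ * invMean Z n ω := by
            refine (h.lastShare_le hn1 ω).trans ?_
            calc (Z n ω).1 * invMean Z n ω / n ≤ √(n : ℝ) * invMean Z n ω / n := by
                  gcongr; exact not_lt.1 hlt
              _ = (√(n : ℝ))⁻¹ * invMean Z n ω := by
                  nth_rewrite 2 [← Real.mul_self_sqrt hn0.le]
                  field_simp
          calc |g (Z n ω)| * invMean Z n ω ^ k * lastShare Z n ω
              ≤ |g (Z n ω)| * invMean Z n ω ^ k * ((√(n : ℝ))⁻¹ * invMean Z n ω) := by gcongr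
            _ = _ := by ring
    _ = (∫ ω, tail n (Z 0 ω) ∂P) * (∫ ω, invMean Z n ω ^ k ∂P) +
          (√(n : ℝ))⁻¹ * ((∫ ω, |g (Z 0 ω)| ∂P) * ∫ ω, invMean Z n ω ^ (k + 1) ∂P) := by
        rw [integral_add i1 (i2.const_mul _), integral_const_mul]
        congr 1
        · exact h.integral_last_mul n (mtail n) (measurable_inv_pow n k)
        · congr 1
          exact h.integral_last_mul n hg.abs (measurable_inv_pow n (k + 1))
    _ ≤ _ := by
        have : 0 ≤ ∫ ω, tail n (Z 0 ω) ∂P := integral_nonneg fun ω => by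
          simp only [htail]; split_ifs <;> simp
        have : 0 ≤ ∫ ω, |g (Z 0 ω)| ∂P := integral_nonneg fun ω => abs_nonneg _
        gcongr
        · exact hn.2
        · exact hn'.2

lemma memLp_component (h : IsRatioSequence Z P) (j : ℕ) :
    MemLp (fun ω => (Z j ω).1) 2 P ∧ MemLp (fun ω => (Z j ω).2) 2 P :=
  ⟨((h.ident j).comp measurable_fst).memLp_iff.2 h.memLp_fst,
    ((h.ident j).comp measurable_snd).memLp_iff.2 h.memLp_snd⟩

/-- The law of large numbers in `L²`. -/
lemma integral_sq_mean_sub_le (h : IsRatioSequence Z P) {f : ℝ × ℝ → ℝ} (hf : Measurable f)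
    (hf2 : MemLp (fun ω => f (Z 0 ω)) 2 P) {n : ℕ} (hn : 1 ≤ n) :
    MemLp (fun ω => (∑ j ∈ Finset.range n, f (Z j ω)) / n - ∫ ω, f (Z 0 ω) ∂P) 2 P ∧
      ∫ ω, ((∑ j ∈ Finset.range n, f (Z j ω)) / n - ∫ ω, f (Z 0 ω) ∂P) ^ 2 ∂P ≤
        Var[fun ω => f (Z 0 ω); P] / n := by
  have := h.isProbability
  have hn0 : (0 : ℝ) < n := by exact_mod_cast hn
  have hL : ∀ j, MemLp (fun ω => f (Z j ω)) 2 P := fun j =>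
    ((h.ident j).comp hf).memLp_iff.2 hf2
  have hS : MemLp (fun ω => ∑ j ∈ Finset.range n, f (Z j ω)) 2 P :=
    memLp_finsetSum _ fun j _ => hL j
  have hM : MemLp (fun ω => (∑ j ∈ Finset.range n, f (Z j ω)) / n) 2 P := by
    simpa only [div_eq_inv_mul] using hS.const_mul (n : ℝ)⁻¹
  refine ⟨hM.sub (memLp_const _), ?_⟩
  have hmean : ∫ ω, (∑ j ∈ Finset.range n, f (Z j ω)) / n ∂P = ∫ ω, f (Z 0 ω) ∂P := by
    rw [integral_div, integral_finsetSum _ fun j _ => (hL j).integrable (by norm_num)]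
    rw [Finset.sum_congr rfl fun j _ => h.integral_last j hf]
    simp
    field_simp
  have hvar := variance_eq_integral hM.aestronglyMeasurable.aemeasurable
  rw [hmean] at hvar
  rw [← hvar]
  have hsum : Var[fun ω => ∑ j ∈ Finset.range n, f (Z j ω); P] =
      n * Var[fun ω => f (Z 0 ω); P] := by
    have := IndepFun.variance_sum (μ := P) (X := fun j ω => f (Z j ω)) (s := Finset.range n)
      (fun j _ => hL j) (fun i _ j _ hij => (h.indep.indepFun hij).comp hf hf)
    rw [show (fun ω => ∑ j ∈ Finset.range n, f (Z j ω)) =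
      ∑ j ∈ Finset.range n, fun ω => f (Z j ω) by ext ω; simp, this]
    have hv : ∀ j, Var[fun ω => f (Z j ω); P] = Var[fun ω => f (Z 0 ω); P] := fun j =>
      ((h.ident j).comp hf).variance_eq
    simp [hv]
  simp_rw [div_eq_inv_mul]
  rw [variance_const_mul, hsum]
  refine le_of_eq ?_
  field_simp

lemma memLp_invMean_pow (h : IsRatioSequence Z P) {n k : ℕ}
    (hA : Integrable (fun ω => invMean Z n ω ^ (2 * k)) P) :
    MemLp (fun ω => invMean Z n ω ^ k) 2 P := by
  rw [memLp_two_iff_integrable_sq ((h.measurable_invMean n).pow_const k).aestronglyMeasurable]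
  simpa only [← pow_mul, mul_comm] using hA

lemma integral_fst_pos (h : IsRatioSequence Z P) : 0 < ∫ ω, (Z 0 ω).1 ∂P := by
  have := h.isProbability
  rw [integral_pos_iff_support_of_nonneg (fun ω => (h.pos 0 ω).le)
    (h.memLp_fst.integrable (by norm_num)),
    Function.support_eq_univ fun ω => (h.pos 0 ω).ne']
  simp

lemma memLp_snd_mean (h : IsRatioSequence Z P) {n : ℕ} (hn : 1 ≤ n) :
    MemLp (fun ω => (partialSum Z (Finset.range n) ω).2 / n) 2 P ∧
      ∫ ω, ((partialSum Z (Finset.range n) ω).2 / n) ^ 2 ∂P ≤ Var[fun ω => (Z 0 ω).2; P] / n := by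
  simpa only [h.integral_snd, sub_zero, ← snd_partialSum] using
    h.integral_sq_mean_sub_le measurable_snd h.memLp_snd hn

/-- Convergence of the second moment of the inverse mean. -/
lemma tendsto_integral_invMean_sq (h : IsRatioSequence Z P) :
    Tendsto (fun n => ∫ ω, invMean Z n ω ^ 2 ∂P) atTop (𝓝 ((∫ ω, (Z 0 ω).1 ∂P)⁻¹ ^ 2)) := by
  have := h.isProbability
  set m := ∫ ω, (Z 0 ω).1 ∂P with hm
  have hm0 : 0 < m := h.integral_fst_pos
  obtain ⟨C₂, -, hC₂⟩ := h.exists_invMean_bound 2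
  obtain ⟨C₄, -, hC₄⟩ := h.exists_invMean_bound 4
  set D : ℕ → Ω → ℝ := fun n ω => (∑ j ∈ Finset.range n, (Z j ω).1) / n - m with hD
  set B : ℕ → Ω → ℝ := fun n ω => m⁻¹ * invMean Z n ω ^ 2 + m⁻¹ ^ 2 * invMean Z n ω ^ 1 with hB
  have hf : ∀ᶠ n : ℕ in atTop, MemLp (D n) 2 P ∧
      ∫ ω, D n ω ^ 2 ∂P ≤ Var[fun ω => (Z 0 ω).1; P] / n := by
    filter_upwards [eventually_ge_atTop 1] with n hn
    exact h.integral_sq_mean_sub_le measurable_fst h.memLp_fst hn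
  have hg : ∀ᶠ n : ℕ in atTop, MemLp (B n) 2 P ∧
      ∫ ω, B n ω ^ 2 ∂P ≤ 2 * (m⁻¹ ^ 2 * C₄ + m⁻¹ ^ 4 * C₂) := by
    filter_upwards [hC₂, hC₄] with n h2 h4
    have hBL : MemLp (B n) 2 P := ((h.memLp_invMean_pow (k := 2) h4.1).const_mul _).add
      ((h.memLp_invMean_pow (k := 1) h2.1).const_mul _)
    refine ⟨hBL, ?_⟩
    calc ∫ ω, B n ω ^ 2 ∂P
        ≤ ∫ ω, 2 * (m⁻¹ ^ 2 * invMean Z n ω ^ 4 + m⁻¹ ^ 4 * invMean Z n ω ^ 2) ∂P := by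
          refine integral_mono hBL.integrable_sq
            (((h4.1.const_mul _).add (h2.1.const_mul _)).const_mul 2) fun ω => ?_
          simp only [hB]
          nlinarith [sq_nonneg (m⁻¹ * invMean Z n ω ^ 2 - m⁻¹ ^ 2 * invMean Z n ω ^ 1)]
      _ = 2 * (m⁻¹ ^ 2 * ∫ ω, invMean Z n ω ^ 4 ∂P + m⁻¹ ^ 4 * ∫ ω, invMean Z n ω ^ 2 ∂P) := by
          rw [integral_const_mul, integral_add (h4.1.const_mul _) (h2.1.const_mul _),
            integral_const_mul, integral_const_mul]
      _ ≤ _ := by gcongr; exacts [h4.2, h2.2]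
  have key := tendsto_integral_abs_mul_zero hf hg
  rw [tendsto_iff_norm_sub_tendsto_zero]
  refine squeeze_zero' (Eventually.of_forall fun n => norm_nonneg _) ?_ key
  filter_upwards [hC₂, hf, hg, eventually_ge_atTop 1] with n h2 hfn hgn hn
  -- With `A = invMean` and `D = A⁻¹ - m`, the identity is `A² - m⁻² = -D (m⁻¹ A² + m⁻² A)`. Here
  -- `D` is small in `L²` by the law of large numbers and the other factor is bounded in `L²`.
  have e : ∫ ω, invMean Z n ω ^ 2 ∂P - m⁻¹ ^ 2 = ∫ ω, -(D n ω * B n ω) ∂P := by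
    rw [show m⁻¹ ^ 2 = ∫ _ : Ω, m⁻¹ ^ 2 ∂P by simp, ← integral_sub h2.1 (integrable_const _)]
    refine integral_congr_ae (ae_of_all _ fun ω => ?_)
    have hT := h.fst_partialSum_pos (s := Finset.range n) (by simp; omega) ω
    have hn0 : (0 : ℝ) < n := by exact_mod_cast hn
    simp only [hD, hB, ← fst_partialSum, invMean]
    field_simp
    ring
  rw [e, Real.norm_eq_abs]
  refine (abs_integral_le_integral_abs).trans_eq ?_
  simp only [abs_neg]

lemma partialSum_range_eq {n j : ℕ} (hj : j ∈ Finset.range (n + 1)) (ω : Ω) :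
    partialSum Z (Finset.range (n + 1)) ω =
      Z j ω + partialSum Z ((Finset.range (n + 1)).erase j) ω :=
  (Finset.add_sum_erase _ (fun i => Z i ω) hj).symm

/-- Exchangeability. -/
lemma identDistrib_total (h : IsRatioSequence Z P) {n j : ℕ} (hj : j ∈ Finset.range (n + 1))
    {F : (ℝ × ℝ) × (ℝ × ℝ) → ℝ} (hF : Measurable F) :
    IdentDistrib (fun ω => F (Z j ω, partialSum Z (Finset.range (n + 1)) ω))
      (fun ω => F (Z n ω, Z n ω + partialSum Z (Finset.range n) ω)) P P := by
  have := (h.identDistrib_erase hj).comp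
    (u := fun z : (ℝ × ℝ) × (ℝ × ℝ) => F (z.1, z.1 + z.2)) (by fun_prop)
  simp_rw [partialSum_range_eq hj]
  exact this

/-- Dropping the term's own weight from the denominator only enlarges the square and leaves a
product of independent integrable factors. -/
lemma memLp_term (h : IsRatioSequence Z P) {n j : ℕ} (hn : 1 ≤ n)
    (hj : j ∈ Finset.range (n + 1)) (hA : Integrable (fun ω => invMean Z n ω ^ 2) P) :
    MemLp (fun ω => (Z j ω).2 / (partialSum Z (Finset.range (n + 1)) ω).1) 2 P := by
  have hn0 : (0 : ℝ) < n := by exact_mod_cast hn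
  have hid := h.identDistrib_total hj (F := fun z => z.1.2 / z.2.1) (by fun_prop)
  have hmeas : AEStronglyMeasurable (fun ω => (Z n ω).2 /
      (Z n ω + partialSum Z (Finset.range n) ω).1) P :=
    ((h.meas n).snd.div ((h.meas n).add (measurable_partialSum h.meas _)).fst).aestronglyMeasurable
  rw [hid.memLp_iff, memLp_two_iff_integrable_sq hmeas]
  have hprod := h.integrable_last_mul n (f := fun z => z.2 ^ 2) (by fun_prop)
    (measurable_inv_pow n 2) h.memLp_snd.integrable_sq hA
  refine (hprod.const_mul ((n : ℝ)⁻¹ ^ 2)).mono' (hmeas.pow 2)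
    (ae_of_all _ fun ω => ?_)
  have hx := h.pos n ω
  have hT := h.fst_partialSum_pos (s := Finset.range n) (by simp; omega) ω
  simp only [Prod.fst_add]
  rw [Real.norm_of_nonneg (sq_nonneg _), div_pow, mul_pow]
  have : (n : ℝ)⁻¹ ^ 2 * ((Z n ω).2 ^ 2 * ((n : ℝ) ^ 2 *
      (partialSum Z (Finset.range n) ω).1⁻¹ ^ 2)) =
      (Z n ω).2 ^ 2 / (partialSum Z (Finset.range n) ω).1 ^ 2 := by
    field_simp
  rw [this]
  gcongr
  linarith

lemma ratio_eq_sum (n : ℕ) (ω : Ω) :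
    ratio Z n ω =
      ∑ j ∈ Finset.range n, (Z j ω).2 / (partialSum Z (Finset.range n) ω).1 := by
  rw [ratio, snd_partialSum, Finset.sum_div]

lemma memLp_ratio (h : IsRatioSequence Z P) {n : ℕ} (hn : 1 ≤ n)
    (hA : Integrable (fun ω => invMean Z n ω ^ 2) P) : MemLp (ratio Z (n + 1)) 2 P := by
  have : ratio Z (n + 1) = fun ω => ∑ j ∈ Finset.range (n + 1),
      (Z j ω).2 / (partialSum Z (Finset.range (n + 1)) ω).1 := by
    ext ω; exact ratio_eq_sum _ ω
  rw [this]
  exact memLp_finsetSum _ fun j hj => h.memLp_term hn hj hA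

/-- The ratio is square integrable for large sample sizes. -/
lemma eventually_memLp_ratio (h : IsRatioSequence Z P) :
    ∀ᶠ n : ℕ in atTop, MemLp (ratio Z n) 2 P := by
  obtain ⟨C₂, -, hC₂⟩ := h.exists_invMean_bound 2
  rw [← map_add_atTop_eq_nat 1, eventually_map]
  filter_upwards [hC₂, eventually_ge_atTop 1] with n hn hn1
  exact h.memLp_ratio hn1 hn.1

lemma integrable_fst_mul_snd (h : IsRatioSequence Z P) :
    Integrable (fun ω => (Z 0 ω).2 * (Z 0 ω).1) P :=
  h.memLp_snd.integrable_mul h.memLp_fst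

/-- By exchangeability the mean is `n + 1` times that of the last term. The first-order part
vanishes because the second component is centred and independent of the remaining sum; the
second-order part produces the bias. -/
lemma integral_ratio_succ (h : IsRatioSequence Z P) {n : ℕ} (hn : 1 ≤ n)
    (hA : Integrable (fun ω => invMean Z n ω ^ 2) P) :
    ∫ ω, ratio Z (n + 1) ω ∂P = -(((n : ℝ) + 1) / n ^ 2 *
      ((∫ ω, (Z 0 ω).2 * (Z 0 ω).1 ∂P) * (∫ ω, invMean Z n ω ^ 2 ∂P) -
        ∫ ω, (Z n ω).2 * (Z n ω).1 * invMean Z n ω ^ 2 * lastShare Z n ω ∂P)) := by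
  have := h.isProbability
  have hn0 : (0 : ℝ) < n := by exact_mod_cast hn
  have hA1 : Integrable (fun ω => invMean Z n ω ^ 1) P :=
    (h.memLp_invMean_pow (k := 1) hA).integrable (by norm_num)
  have mg : Measurable (fun z : ℝ × ℝ => z.2 * z.1) := by fun_prop
  have i1 : Integrable (fun ω => (Z n ω).2 * invMean Z n ω ^ 1) P :=
    h.integrable_last_mul n measurable_snd (measurable_inv_pow n 1)
      (h.memLp_snd.integrable (by norm_num)) hA1
  have i2 : Integrable (fun ω => (Z n ω).2 * (Z n ω).1 * invMean Z n ω ^ 2) P :=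
    h.integrable_last_mul n mg (measurable_inv_pow n 2) h.integrable_fst_mul_snd hA
  have i3 := h.integrable_share mg h.integrable_fst_mul_snd hA
  have e1 : ∫ ω, (Z n ω).2 * invMean Z n ω ^ 1 ∂P = 0 := by
    refine (h.integral_last_mul n measurable_snd (measurable_inv_pow n 1)).trans ?_
    rw [h.integral_snd, zero_mul]
  have e2 : ∫ ω, (Z n ω).2 * (Z n ω).1 * invMean Z n ω ^ 2 ∂P =
      (∫ ω, (Z 0 ω).2 * (Z 0 ω).1 ∂P) * ∫ ω, invMean Z n ω ^ 2 ∂P :=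
    h.integral_last_mul n mg (measurable_inv_pow n 2)
  have hsum : ∫ ω, ratio Z (n + 1) ω ∂P =
      ((n : ℝ) + 1) * ∫ ω, (Z n ω).2 / ((Z n ω).1 + (partialSum Z (Finset.range n) ω).1) ∂P := by
    simp_rw [ratio_eq_sum]
    rw [integral_finsetSum _ fun j hj => (h.memLp_term hn hj hA).integrable (by norm_num)]
    rw [Finset.sum_congr rfl fun j hj =>
      (h.identDistrib_total hj (F := fun z => z.1.2 / z.2.1) (by fun_prop)).integral_eq]
    simp
  have hpt : ∀ ω, (Z n ω).2 / ((Z n ω).1 + (partialSum Z (Finset.range n) ω).1) =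
      (n : ℝ)⁻¹ * ((Z n ω).2 * invMean Z n ω ^ 1) -
        ((n : ℝ)⁻¹ ^ 2 * ((Z n ω).2 * (Z n ω).1 * invMean Z n ω ^ 2) -
        (n : ℝ)⁻¹ ^ 2 * ((Z n ω).2 * (Z n ω).1 * invMean Z n ω ^ 2 * lastShare Z n ω)) := by
    intro ω
    -- Inserting the share into itself once gives `1/(x+T) = A/n - x A²/n² + x A² s/n²`, where `A =
    -- invMean` and `s` is the share.
    have hs : lastShare Z n ω = (Z n ω).1 * (invMean Z n ω / n * (1 - lastShare Z n ω)) := by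
      rw [← h.inv_add_eq hn, lastShare, div_eq_mul_inv]
    rw [div_eq_mul_inv, h.inv_add_eq hn]
    linear_combination (-(Z n ω).2 * invMean Z n ω / n) * hs
  have i4 : Integrable (fun ω => (n : ℝ)⁻¹ ^ 2 * ((Z n ω).2 * (Z n ω).1 * invMean Z n ω ^ 2) -
      (n : ℝ)⁻¹ ^ 2 * ((Z n ω).2 * (Z n ω).1 * invMean Z n ω ^ 2 * lastShare Z n ω)) P :=
    (i2.const_mul _).sub (i3.const_mul _)
  rw [hsum, integral_congr_ae (ae_of_all _ hpt), integral_sub (i1.const_mul _) i4,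
    integral_sub (i2.const_mul _) (i3.const_mul _), integral_const_mul, integral_const_mul,
    integral_const_mul, e1, e2]
  field_simp
  ring

lemma tendsto_succ_div : Tendsto (fun n : ℕ => ((n : ℝ) + 1) / n) atTop (𝓝 1) := by
  have : Tendsto (fun n : ℕ => 1 + (n : ℝ)⁻¹) atTop (𝓝 (1 + 0)) :=
    tendsto_const_nhds.add tendsto_natCast_atTop_atTop.inv_tendsto_atTop
  rw [add_zero] at this
  refine this.congr' ?_
  filter_upwards [eventually_ge_atTop 1] with n hn
  have hn0 : (0 : ℝ) < n := by exact_mod_cast hn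
  field_simp

lemma tendsto_integral_of_tendsto_integral_abs {f : ℕ → Ω → ℝ}
    (hf : Tendsto (fun n => ∫ ω, |f n ω| ∂P) atTop (𝓝 0)) :
    Tendsto (fun n => ∫ ω, f n ω ∂P) atTop (𝓝 0) := by
  rw [tendsto_zero_iff_norm_tendsto_zero]
  exact squeeze_zero (fun n => norm_nonneg _) (fun n => norm_integral_le_integral_norm _) hf

/-- The bias of the ratio. -/
theorem tendsto_mul_integral_ratio (h : IsRatioSequence Z P) :
    Tendsto (fun n : ℕ => (n : ℝ) * ∫ ω, ratio Z n ω ∂P) atTop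
      (𝓝 (-((∫ ω, (Z 0 ω).2 * (Z 0 ω).1 ∂P) * (∫ ω, (Z 0 ω).1 ∂P)⁻¹ ^ 2))) := by
  rw [← tendsto_add_atTop_iff_nat 1]
  obtain ⟨C₂, -, hC₂⟩ := h.exists_invMean_bound 2
  have hshare := tendsto_integral_of_tendsto_integral_abs
    (h.tendsto_share_zero 2 (g := fun z => z.2 * z.1) (by fun_prop) h.integrable_fst_mul_snd)
  have hlim := ((tendsto_succ_div.pow 2).mul
    ((h.tendsto_integral_invMean_sq.const_mul (∫ ω, (Z 0 ω).2 * (Z 0 ω).1 ∂P)).sub hshare)).neg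
  rw [one_pow, one_mul, sub_zero] at hlim
  refine hlim.congr' ?_
  filter_upwards [hC₂, eventually_ge_atTop 1] with n hn hn1
  have hn0 : (0 : ℝ) < n := by exact_mod_cast hn1
  rw [h.integral_ratio_succ hn1 hn.1]
  push_cast
  field_simp

/-- The same leave-one-out argument, with `(1-s)² = 1 - s(2-s)` for the squared denominator; the
product with the sum over the other indices drops out at leading order by centring. -/
lemma integral_ratio_sq_succ (h : IsRatioSequence Z P) {n : ℕ} (hn : 1 ≤ n)
    (hA : Integrable (fun ω => invMean Z n ω ^ 2) P)
    (hA4 : Integrable (fun ω => invMean Z n ω ^ 4) P) :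
    ∫ ω, ratio Z (n + 1) ω ^ 2 ∂P = ((n : ℝ) + 1) / n ^ 2 *
      ((∫ ω, (Z 0 ω).2 ^ 2 ∂P) * (∫ ω, invMean Z n ω ^ 2 ∂P) -
        (∫ ω, (Z n ω).2 ^ 2 * invMean Z n ω ^ 2 * lastShare Z n ω *
          (2 - lastShare Z n ω) ∂P) -
        ∫ ω, (Z n ω).2 * ((partialSum Z (Finset.range n) ω).2 * invMean Z n ω ^ 2) *
          (lastShare Z n ω * (2 - lastShare Z n ω)) ∂P) := by
  have := h.isProbability
  have hn0 : (0 : ℝ) < n := by exact_mod_cast hn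
  have ms := h.measurable_lastShare n
  have hbd : ∀ ω, |lastShare Z n ω * (2 - lastShare Z n ω)| ≤ 1 := fun ω => by
    rw [abs_le]
    constructor <;> nlinarith [h.lastShare_nonneg n ω, h.lastShare_le_one n ω]
  have mulbd : ∀ f : Ω → ℝ, Integrable f P →
      Integrable (fun ω => f ω * (lastShare Z n ω * (2 - lastShare Z n ω))) P := fun f hf =>
    hf.mul_bdd (c := 1) (ms.mul (measurable_const.sub ms)).aestronglyMeasurable
      (ae_of_all _ hbd)
  have mg : Measurable (fun z : ℝ × ℝ => z.2 ^ 2) := by fun_prop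
  have i1 : Integrable (fun ω => (Z n ω).2 ^ 2 * invMean Z n ω ^ 2) P :=
    h.integrable_last_mul n mg (measurable_inv_pow n 2) h.memLp_snd.integrable_sq hA
  have mW : Measurable (fun z : ℝ × ℝ => z.2 * ((n : ℝ) * z.1⁻¹) ^ 2) := by fun_prop
  have hW2 : MemLp (fun ω => (partialSum Z (Finset.range n) ω).2) 2 P := by
    simp_rw [snd_partialSum]
    exact memLp_finsetSum _ fun j _ => (h.memLp_component j).2
  have i2 : Integrable (fun ω =>
      (Z n ω).2 * ((partialSum Z (Finset.range n) ω).2 * invMean Z n ω ^ 2)) P :=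
    h.integrable_last_mul n measurable_snd mW (h.memLp_snd.integrable (by norm_num))
      (hW2.integrable_mul (h.memLp_invMean_pow (k := 2) hA4))
  have i3 : Integrable (fun ω => (Z n ω).2 ^ 2 * invMean Z n ω ^ 2 * lastShare Z n ω *
      (2 - lastShare Z n ω)) P := by
    simpa only [← mul_assoc] using mulbd _ i1
  have i4 := mulbd _ i2
  have e1 : ∫ ω, (Z n ω).2 ^ 2 * invMean Z n ω ^ 2 ∂P =
      (∫ ω, (Z 0 ω).2 ^ 2 ∂P) * ∫ ω, invMean Z n ω ^ 2 ∂P :=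
    h.integral_last_mul n mg (measurable_inv_pow n 2)
  have e2 : ∫ ω, (Z n ω).2 * ((partialSum Z (Finset.range n) ω).2 * invMean Z n ω ^ 2) ∂P = 0 := by
    refine (h.integral_last_mul n measurable_snd mW).trans ?_
    rw [h.integral_snd, zero_mul]
  -- Only one factor of the square is expanded. The other is symmetric in the indices, so
  -- exchangeability applies to each summand.
  have hterm : ∀ ω, ratio Z (n + 1) ω ^ 2 = ∑ j ∈ Finset.range (n + 1),
      (Z j ω).2 / (partialSum Z (Finset.range (n + 1)) ω).1 * ratio Z (n + 1) ω := fun ω => by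
    rw [← Finset.sum_mul, ← ratio_eq_sum, sq]
  have hsum : ∫ ω, ratio Z (n + 1) ω ^ 2 ∂P = ((n : ℝ) + 1) *
      ∫ ω, (Z n ω).2 / ((Z n ω).1 + (partialSum Z (Finset.range n) ω).1) *
        (((Z n ω).2 + (partialSum Z (Finset.range n) ω).2) /
          ((Z n ω).1 + (partialSum Z (Finset.range n) ω).1)) ∂P := by
    simp_rw [hterm]
    have hint : ∀ j ∈ Finset.range (n + 1), Integrable (fun ω =>
        (Z j ω).2 / (partialSum Z (Finset.range (n + 1)) ω).1 * ratio Z (n + 1) ω) P :=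
      fun j hj => (h.memLp_term hn hj hA).integrable_mul (h.memLp_ratio hn hA)
    rw [integral_finsetSum _ hint]
    have hF : Measurable (fun z : (ℝ × ℝ) × (ℝ × ℝ) => z.1.2 / z.2.1 * (z.2.2 / z.2.1)) := by
      fun_prop
    have := fun j (hj : j ∈ Finset.range (n + 1)) => (h.identDistrib_total hj hF).integral_eq
    simp only [Prod.fst_add, Prod.snd_add] at this
    simp only [ratio]
    rw [Finset.sum_congr rfl this]
    simp
  have hpt : ∀ ω, (Z n ω).2 / ((Z n ω).1 + (partialSum Z (Finset.range n) ω).1) *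
        (((Z n ω).2 + (partialSum Z (Finset.range n) ω).2) /
          ((Z n ω).1 + (partialSum Z (Finset.range n) ω).1)) =
      (n : ℝ)⁻¹ ^ 2 * ((((Z n ω).2 ^ 2 * invMean Z n ω ^ 2) +
        (Z n ω).2 * ((partialSum Z (Finset.range n) ω).2 * invMean Z n ω ^ 2)) -
        (Z n ω).2 ^ 2 * invMean Z n ω ^ 2 * lastShare Z n ω * (2 - lastShare Z n ω) -
        (Z n ω).2 * ((partialSum Z (Finset.range n) ω).2 * invMean Z n ω ^ 2) *
          (lastShare Z n ω * (2 - lastShare Z n ω))) := by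
    intro ω
    rw [div_eq_mul_inv, div_eq_mul_inv, h.inv_add_eq hn]
    ring
  have i5 : Integrable (fun ω => (Z n ω).2 ^ 2 * invMean Z n ω ^ 2 +
      (Z n ω).2 * ((partialSum Z (Finset.range n) ω).2 * invMean Z n ω ^ 2) -
      (Z n ω).2 ^ 2 * invMean Z n ω ^ 2 * lastShare Z n ω * (2 - lastShare Z n ω)) P :=
    (i1.add i2).sub i3
  rw [hsum, integral_congr_ae (ae_of_all _ hpt), integral_const_mul, integral_sub i5 i4, 
    integral_sub (i1.fun_add i2) i3, integral_add i1 i2, e1, e2]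
  field_simp
  ring

/-- Bounding the share by `x · invMean / n` turns the centred sum into a mean, which is
`O(n^{-1/2})` in `L²`. The price is a third power of `invMean`, hence the sixth moment. -/
lemma tendsto_cross_term (h : IsRatioSequence Z P) :
    Tendsto (fun n : ℕ => ∫ ω, (Z n ω).2 *
      ((partialSum Z (Finset.range n) ω).2 * invMean Z n ω ^ 2) *
        (lastShare Z n ω * (2 - lastShare Z n ω)) ∂P) atTop (𝓝 0) := by
  obtain ⟨C₆, -, hC₆⟩ := h.exists_invMean_bound 6
  have hf : ∀ᶠ n : ℕ in atTop, MemLp (fun ω => (partialSum Z (Finset.range n) ω).2 / n) 2 P ∧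
      ∫ ω, ((partialSum Z (Finset.range n) ω).2 / n) ^ 2 ∂P ≤
        Var[fun ω => (Z 0 ω).2; P] / n := by
    filter_upwards [eventually_ge_atTop 1] with n hn
    exact h.memLp_snd_mean hn
  have hg : ∀ᶠ n : ℕ in atTop, MemLp (fun ω => invMean Z n ω ^ 3) 2 P ∧
      ∫ ω, (invMean Z n ω ^ 3) ^ 2 ∂P ≤ C₆ := by
    filter_upwards [hC₆] with n hn
    refine ⟨h.memLp_invMean_pow (k := 3) hn.1, ?_⟩
    simpa only [← pow_mul] using hn.2
  have hlim := (tendsto_integral_abs_mul_zero hf hg).const_mul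
    (2 * ∫ ω, |(Z 0 ω).2 * (Z 0 ω).1| ∂P)
  rw [mul_zero] at hlim
  rw [tendsto_zero_iff_norm_tendsto_zero]
  refine squeeze_zero' (Eventually.of_forall fun n => norm_nonneg _) ?_ hlim
  filter_upwards [hf, hg, eventually_ge_atTop 1] with n hfn hgn hn
  have hn0 : (0 : ℝ) < n := by exact_mod_cast hn
  have mf : Measurable (fun z : ℝ × ℝ => |z.2 * z.1|) := by fun_prop
  have mg : Measurable (fun z : ℝ × ℝ => |z.2 / n * ((n : ℝ) * z.1⁻¹) ^ 3|) := by fun_prop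
  have i1 : Integrable (fun ω => |(Z n ω).2 * (Z n ω).1| *
      |(partialSum Z (Finset.range n) ω).2 / n * invMean Z n ω ^ 3|) P :=
    h.integrable_last_mul n mf mg h.integrable_fst_mul_snd.abs (hfn.1.integrable_mul hgn.1).abs
  have e1 : ∫ ω, |(Z n ω).2 * (Z n ω).1| *
      |(partialSum Z (Finset.range n) ω).2 / n * invMean Z n ω ^ 3| ∂P =
      (∫ ω, |(Z 0 ω).2 * (Z 0 ω).1| ∂P) *
        ∫ ω, |(partialSum Z (Finset.range n) ω).2 / n * invMean Z n ω ^ 3| ∂P :=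
    h.integral_last_mul n mf mg
  rw [mul_assoc, ← e1, ← integral_const_mul]
  refine norm_integral_le_of_norm_le (i1.const_mul 2) (ae_of_all _ fun ω => ?_)
  have hA := h.invMean_nonneg n ω
  have hs := h.lastShare_nonneg n ω
  have hs1 := h.lastShare_le_one n ω
  have hx := h.pos n ω
  rw [Real.norm_eq_abs]
  simp only [abs_mul, abs_div, abs_of_nonneg hs, abs_of_nonneg (pow_nonneg hA _),
    abs_of_pos hx, abs_of_pos hn0, abs_of_nonneg (sub_nonneg.2 (hs1.trans one_le_two))]
  calc |(Z n ω).2| * (|(partialSum Z (Finset.range n) ω).2| * invMean Z n ω ^ 2) *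
        (lastShare Z n ω * (2 - lastShare Z n ω))
      ≤ |(Z n ω).2| * (|(partialSum Z (Finset.range n) ω).2| * invMean Z n ω ^ 2) *
        (((Z n ω).1 * invMean Z n ω / n) * 2) := by
        gcongr
        · linarith
        · exact h.lastShare_le hn ω
        · linarith
    _ = _ := by ring

theorem tendsto_mul_integral_ratio_sq (h : IsRatioSequence Z P) :
    Tendsto (fun n : ℕ => (n : ℝ) * ∫ ω, ratio Z n ω ^ 2 ∂P) atTop
      (𝓝 ((∫ ω, (Z 0 ω).2 ^ 2 ∂P) * (∫ ω, (Z 0 ω).1 ∂P)⁻¹ ^ 2)) := by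
  rw [← tendsto_add_atTop_iff_nat 1]
  obtain ⟨C₂, -, hC₂⟩ := h.exists_invMean_bound 2
  obtain ⟨C₄, -, hC₄⟩ := h.exists_invMean_bound 4
  have mg : Measurable (fun z : ℝ × ℝ => z.2 ^ 2) := by fun_prop
  have hshare := h.tendsto_share_zero 2 mg h.memLp_snd.integrable_sq
  have hshare2 : Tendsto (fun n : ℕ => ∫ ω, (Z n ω).2 ^ 2 * invMean Z n ω ^ 2 *
      lastShare Z n ω * (2 - lastShare Z n ω) ∂P) atTop (𝓝 0) := by
    have hlim := hshare.const_mul 2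
    rw [mul_zero] at hlim
    rw [tendsto_zero_iff_norm_tendsto_zero]
    refine squeeze_zero' (Eventually.of_forall fun n => norm_nonneg _) ?_ hlim
    filter_upwards [hC₂] with n hn
    rw [← integral_const_mul]
    refine norm_integral_le_of_norm_le
      ((h.integrable_share mg h.memLp_snd.integrable_sq hn.1).abs.const_mul 2)
      (ae_of_all _ fun ω => ?_)
    have hs := h.lastShare_nonneg n ω
    have hs1 := h.lastShare_le_one n ω
    rw [norm_mul, mul_comm, Real.norm_eq_abs, Real.norm_eq_abs,
      abs_of_nonneg (sub_nonneg.2 (hs1.trans one_le_two))]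
    gcongr
    linarith
  have hlim := (tendsto_succ_div.pow 2).mul
    (((h.tendsto_integral_invMean_sq.const_mul (∫ ω, (Z 0 ω).2 ^ 2 ∂P)).sub hshare2).sub
      h.tendsto_cross_term)
  rw [one_pow, one_mul, sub_zero, sub_zero] at hlim
  refine hlim.congr' ?_
  filter_upwards [hC₂, hC₄, eventually_ge_atTop 1] with n hn hn4 hn1
  have hn0 : (0 : ℝ) < n := by exact_mod_cast hn1
  rw [h.integral_ratio_sq_succ hn1 hn.1 hn4.1]
  push_cast
  field_simp

/-- The asymptotic variance of the ratio. -/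
theorem tendsto_mul_variance_ratio (h : IsRatioSequence Z P) :
    Tendsto (fun n : ℕ => (n : ℝ) * Var[ratio Z n; P]) atTop
      (𝓝 ((∫ ω, (Z 0 ω).2 ^ 2 ∂P) * (∫ ω, (Z 0 ω).1 ∂P)⁻¹ ^ 2)) := by
  have := h.isProbability
  -- The squared mean is `O(n⁻²)`, so it does not contribute to `n` times the variance.
  have hmean := (h.tendsto_mul_integral_ratio.pow 2).mul
    (tendsto_natCast_atTop_atTop (R := ℝ)).inv_tendsto_atTop
  have hlim := h.tendsto_mul_integral_ratio_sq.sub hmean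
  rw [mul_zero, sub_zero] at hlim
  refine hlim.congr' ?_
  filter_upwards [h.eventually_memLp_ratio, eventually_ge_atTop 1] with n hn hn1
  have hn0 : (0 : ℝ) < n := by exact_mod_cast hn1
  rw [variance_eq_sub hn]
  simp only [Pi.pow_apply, Pi.inv_apply]
  field_simp

end IsRatioSequence

end RatioLimits

/-! ### Differentiation under the integral sign. -/

section ParametricIntegral

variable {E : Type*} [MeasurableSpace E] {Q : Measure E}

lemma aestronglyMeasurable_deriv {F : E → ℝ → ℝ} {t₀ r : ℝ} (hr : 0 < r)
    (hmeas : ∀ t ∈ Set.Ioo (t₀ - r) (t₀ + r), AEStronglyMeasurable (fun e => F e t) Q)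
    (hdiff : ∀ᵐ e ∂Q, DifferentiableAt ℝ (F e) t₀) :
    AEStronglyMeasurable (fun e => deriv (F e) t₀) Q := by
  -- The derivative is an almost sure limit of difference quotients. The shift by two keeps every
  -- step strictly below `r`, including `n = 0`.
  have hpos : ∀ n : ℕ, 0 < r / ((n : ℝ) + 2) := fun n => by positivity
  have hlt : ∀ n : ℕ, r / ((n : ℝ) + 2) < r := fun n =>
    div_lt_self hr (by have : (0 : ℝ) ≤ n := n.cast_nonneg
                       linarith)
  have hlim : Tendsto (fun n : ℕ => r / ((n : ℝ) + 2)) atTop (𝓝[≠] 0) := by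
    refine tendsto_nhdsWithin_iff.2 ⟨?_, Eventually.of_forall fun n => (hpos n).ne'⟩
    exact tendsto_const_nhds.div_atTop
      (tendsto_atTop_add_const_right _ _ tendsto_natCast_atTop_atTop)
  refine aestronglyMeasurable_of_tendsto_ae atTop (f := fun (n : ℕ) e =>
    (r / ((n : ℝ) + 2))⁻¹ * (F e (t₀ + r / ((n : ℝ) + 2)) - F e t₀)) (fun n => ?_) ?_
  · exact ((hmeas (t₀ + r / ((n : ℝ) + 2)) ⟨by linarith [hpos n], by linarith [hlt n]⟩).sub
      (hmeas t₀ ⟨by linarith, by linarith⟩)).const_mul _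
  · filter_upwards [hdiff] with e he
    exact (hasDerivAt_iff_tendsto_slope_zero.1 he.hasDerivAt).comp hlim

/-- Differentiation under the integral sign when the supremum of the derivative, which need not be
measurable, has a finite lower integral. -/
theorem hasDerivAt_integral_of_lintegral_iSup_deriv {F : E → ℝ → ℝ} {t₀ r : ℝ} (hr : 0 < r)
    (hmeas : ∀ t ∈ Set.Ioo (t₀ - r) (t₀ + r), AEStronglyMeasurable (fun e => F e t) Q)
    (hint : Integrable (fun e => F e t₀) Q)
    (hdiff : ∀ᵐ e ∂Q, ∀ t ∈ Set.Ioo (t₀ - r) (t₀ + r), DifferentiableAt ℝ (F e) t)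
    (hsup : ∫⁻ e, (⨆ t ∈ Set.Ioo (t₀ - r) (t₀ + r), ENNReal.ofReal |deriv (F e) t|) ∂Q < ⊤) :
    HasDerivAt (fun t => ∫ e, F e t ∂Q) (∫ e, deriv (F e) t₀ ∂Q) t₀ ∧
      ∀ᶠ t in 𝓝 t₀, Integrable (fun e => F e t) Q := by
  set I := Set.Ioo (t₀ - r) (t₀ + r) with hI
  let ι := {p : ℚ × ℚ // (p.1 : ℝ) ∈ I ∧ (p.2 : ℝ) ∈ I}
  -- Difference quotients over rational pairs: a countable supremum, hence measurable, and below the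
  -- supremum of the derivative by the mean value theorem.
  set K : E → ENNReal := fun e => ⨆ p : ι,
    ENNReal.ofReal (|F e p.1.1 - F e p.1.2| / |(p.1.1 : ℝ) - p.1.2|) with hK
  have mK : AEMeasurable K Q := AEMeasurable.iSup fun p =>
    (((hmeas _ p.2.1).sub (hmeas _ p.2.2)).aemeasurable.abs.div_const _).ennreal_ofReal
  have slope : ∀ (g : ℝ → ℝ), (∀ t ∈ I, DifferentiableAt ℝ g t) → ∀ a ∈ I, ∀ b ∈ I, a < b →
      ENNReal.ofReal (|g b - g a| / |b - a|) ≤ ⨆ t ∈ I, ENNReal.ofReal |deriv g t| := by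
    intro g hg a ha b hb hab
    have hsub : Set.Icc a b ⊆ I := fun x hx => ⟨ha.1.trans_le hx.1, hx.2.trans_lt hb.2⟩
    obtain ⟨c, hc, hceq⟩ := exists_deriv_eq_slope g hab
      (fun x hx => (hg x (hsub hx)).continuousAt.continuousWithinAt)
      (fun x hx => (hg x (hsub (Set.Ioo_subset_Icc_self hx))).differentiableWithinAt)
    rw [← abs_div, ← hceq]
    exact le_iSup₂_of_le c (hsub (Set.Ioo_subset_Icc_self hc)) le_rfl
  have hKle : ∀ᵐ e ∂Q, K e ≤ ⨆ t ∈ I, ENNReal.ofReal |deriv (F e) t| := by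
    filter_upwards [hdiff] with e he
    refine iSup_le fun p => ?_
    rcases lt_trichotomy (p.1.1 : ℝ) p.1.2 with h | h | h
    · rw [abs_sub_comm, abs_sub_comm (p.1.1 : ℝ)]
      exact slope (F e) he _ p.2.1 _ p.2.2 h
    · simp [h]
    · exact slope (F e) he _ p.2.2 _ p.2.1 h
  have hKint : ∫⁻ e, K e ∂Q < ⊤ := (lintegral_mono_ae hKle).trans_lt hsup
  have hKfin : ∀ᵐ e ∂Q, K e < ⊤ := ae_lt_top' mK hKint.ne
  have iK : Integrable (fun e => (K e).toReal) Q :=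
    integrable_toReal_of_lintegral_ne_top mK hKint.ne
  set J := Set.Ioo (t₀ - r / 2) (t₀ + r / 2) with hJ
  have hJI : Set.Icc (t₀ - r / 2) (t₀ + r / 2) ⊆ I := fun x hx =>
    ⟨by linarith [hx.1], by linarith [hx.2]⟩
  have hJn : J ∈ 𝓝 t₀ := Ioo_mem_nhds (by linarith) (by linarith)
  have hlip : ∀ᵐ e ∂Q, LipschitzOnWith (Real.nnabs (K e).toReal) (F e) J := by
    filter_upwards [hdiff, hKfin] with e he hfin
    have hcl : closure (J ∩ Set.range ((↑) : ℚ → ℝ)) ⊆ Set.Icc (t₀ - r / 2) (t₀ + r / 2) :=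
      closure_minimal (Set.inter_subset_left.trans Set.Ioo_subset_Icc_self) isClosed_Icc
    have hrat : LipschitzOnWith (Real.nnabs (K e).toReal) (F e)
        (J ∩ Set.range ((↑) : ℚ → ℝ)) := by
      refine LipschitzOnWith.of_dist_le_mul ?_
      rintro _ ⟨hx, x, rfl⟩ _ ⟨hy, y, rfl⟩
      rcases eq_or_ne (x : ℝ) y with h | h
      · simp [h]
      · have hle := (le_iSup (fun p : ι =>
          ENNReal.ofReal (|F e p.1.1 - F e p.1.2| / |(p.1.1 : ℝ) - p.1.2|))
          ⟨(x, y), hJI (Set.Ioo_subset_Icc_self hx), hJI (Set.Ioo_subset_Icc_self hy)⟩)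
        have hle2 := (ENNReal.ofReal_le_iff_le_toReal hfin.ne).1 hle
        rw [Real.dist_eq, Real.dist_eq, Real.coe_nnabs, abs_of_nonneg ENNReal.toReal_nonneg]
        exact (div_le_iff₀ (abs_pos.2 (sub_ne_zero.2 h))).1 hle2
    -- The Lipschitz bound extends from rational points to all of `J` by density and continuity.
    refine LipschitzOnWith.mono ((lipschitzOnWith_closure_iff fun x hx =>
      (he x (hJI (hcl hx))).continuousAt.continuousWithinAt).2 hrat) ?_
    exact Rat.denseRange_cast.open_subset_closure_inter isOpen_Ioo
  have ht₀ : t₀ ∈ I := ⟨by linarith, by linarith⟩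
  have hder : ∀ᵐ e ∂Q, HasDerivAt (F e) (deriv (F e) t₀) t₀ :=
    hdiff.mono fun e he => (he t₀ ht₀).hasDerivAt
  refine ⟨(hasDerivAt_integral_of_dominated_loc_of_lip hJn ?_ hint
    (aestronglyMeasurable_deriv hr hmeas (hdiff.mono fun e he => he t₀ ht₀)) hlip iK hder).2, ?_⟩
  · filter_upwards [hJn] with t ht using hmeas t (hJI (Set.Ioo_subset_Icc_self ht))
  · filter_upwards [hJn] with t ht
    refine ((iK.mul_const |t - t₀|).add hint.abs).mono' (hmeas t (hJI (Set.Ioo_subset_Icc_self ht)))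
      ?_
    filter_upwards [hlip] with e he
    have h1 := he.dist_le_mul t ht t₀ (mem_of_mem_nhds hJn)
    rw [Real.dist_eq, Real.dist_eq, Real.coe_nnabs, abs_of_nonneg ENNReal.toReal_nonneg] at h1
    have h2 : |F e t| ≤ |F e t - F e t₀| + |F e t₀| := by
      simpa using abs_add_le (F e t - F e t₀) (F e t₀)
    simp only [Pi.add_apply, Real.norm_eq_abs]
    linarith

end ParametricIntegral

/-! ### Coordinate lines in the parameter space. -/

section Curve

variable {a b : ℕ} (ψ : Fin a ⊕ Fin b) (η : Param a b)

@[simp] lemma component_replace (t : ℝ) : component ψ (replace ψ η t) = t := by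
  cases ψ <;> simp [component, replace]

@[simp] lemma replace_replace (s t : ℝ) : replace ψ (replace ψ η t) s = replace ψ η s := by
  cases ψ <;> simp [replace]

@[simp] lemma replace_component : replace ψ η (component ψ η) = η := by
  cases ψ <;> simp [component, replace]

lemma differentiable_replace : Differentiable ℝ (replace ψ η) := by
  have hu : ∀ {n : ℕ} (x : Fin n → ℝ) (i : Fin n),
      Differentiable ℝ (fun t : ℝ => Function.update x i t) := fun x i t =>
    (hasDerivAt_update x i t).differentiableAt
  cases ψ with
  | inl i => exact (hu η.1 i).prodMk (differentiable_const _)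
  | inr k => exact (differentiable_const _).prodMk (hu η.2 k)

lemma pderiv_replace (g : Param a b → ℝ) (t : ℝ) :
    pderiv ψ g (replace ψ η t) = deriv (fun s => g (replace ψ η s)) t := by
  simp [pderiv]

end Curve

/-! ### Positivity, measurability and smoothness of the reparameterized weight. -/

namespace Model

variable {a b d : ℕ} {E : Type*} [MeasurableSpace E] {S : Model a b d E}

/-- The density `q` integrates to one, so `ν ≠ 0` and the posterior is positive somewhere. A zero
marginal would make it zero everywhere, as division by zero gives zero. -/
lemma Standing.marginal_pos (hS : S.Standing) {θ : Fin a → ℝ} (hθ : θ ∈ S.Θ) (hΦ : S.Φ.Nonempty) :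
    0 < S.marginal θ := by
  obtain ⟨φ, hφ⟩ := hΦ
  have hν : S.ν ≠ 0 := fun h0 => by
    have := hS.q_integral φ hφ
    rw [h0, integral_zero_measure] at this
    exact zero_ne_one this
  have : NeZero S.ν := ⟨hν⟩
  obtain ⟨z, hz⟩ := (hS.posterior_pos θ hθ).exists
  refine lt_of_le_of_ne (integral_nonneg fun z => hS.joint_nonneg θ hθ z) fun h0 => ?_
  rw [posterior, ← h0, div_zero] at hz
  exact lt_irrefl _ hz

/-- Regularity is assumed for the posterior and the marginal; this factorization transfers it to the
joint density. -/
lemma Standing.joint_eq (hS : S.Standing) {θ : Fin a → ℝ} (hθ : θ ∈ S.Θ) (hΦ : S.Φ.Nonempty)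
    (z : Fin d → ℝ) : S.joint θ z = S.posterior θ z * S.marginal θ := by
  rw [posterior, div_mul_cancel₀ _ (hS.marginal_pos hθ hΦ).ne']

lemma Standing.measurable_weight (hS : S.Standing) {η : Param a b} (hη : η ∈ S.Θ ×ˢ S.Φ) :
    Measurable (S.weight η) := by
  have hp : Continuous (S.posterior η.1) := by
    have h1 : ContinuousOn (fun z : Fin d → ℝ => S.posterior η.1 z) Set.univ :=
      hS.posterior_diff.continuousOn.comp (f := fun z : Fin d → ℝ => (z, η.1))
        (by fun_prop) fun z _ => ⟨Set.mem_univ _, hη.1⟩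
    exact continuousOn_univ.1 h1
  have hq : Continuous (S.q η.2) := by
    have h1 : ContinuousOn (fun z : Fin d → ℝ => S.q η.2 z) Set.univ :=
      hS.q_diff.continuousOn.comp (f := fun z : Fin d → ℝ => (z, η.2))
        (by fun_prop) fun z _ => ⟨Set.mem_univ _, hη.2⟩
    exact continuousOn_univ.1 h1
  have : S.weight η = fun z => S.posterior η.1 z * S.marginal η.1 / S.q η.2 z := by
    ext z; rw [weight, hS.joint_eq hη.1 ⟨_, hη.2⟩]
  rw [this]
  exact (hp.measurable.mul_const _).div hq.measurable

lemma Standing.aemeasurable_tw (hS : S.Standing) {η : Param a b} (hη : η ∈ S.Θ ×ˢ S.Φ) :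
    AEMeasurable (fun e => S.tw e η) S.Q :=
  (hS.measurable_weight hη).comp_aemeasurable (hS.f_law η.2 hη.2).aemeasurable

/-- The reparameterized weight is differentiable along the coordinate line of `ψ`. -/
lemma Standing.differentiableAt_tw (hS : S.Standing) {e : E} (he : DifferentiableOn ℝ (S.f e) S.Φ)
    (ψ : Fin a ⊕ Fin b) (η : Param a b) {t : ℝ} (ht : replace ψ η t ∈ S.Θ ×ˢ S.Φ)
    (hq : 0 < S.q (replace ψ η t).2 (S.f e (replace ψ η t).2)) :
    DifferentiableAt ℝ (fun s => S.tw e (replace ψ η s)) t := by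
  have hr := differentiable_replace ψ η t
  have hr1 : DifferentiableAt ℝ (fun s => (replace ψ η s).1) t := hr.fst
  have hr2 : DifferentiableAt ℝ (fun s => (replace ψ η s).2) t := hr.snd
  have hΘ := hS.isOpen_Θ.mem_nhds ht.1
  have hΦ := hS.isOpen_Φ.mem_nhds ht.2
  have hf : DifferentiableAt ℝ (fun s => S.f e (replace ψ η s).2) t :=
    DifferentiableAt.comp t (g := S.f e) (f := fun s => (replace ψ η s).2)
      (he.differentiableAt hΦ) hr2
  have hpost : DifferentiableAt ℝ
      (fun s => S.posterior (replace ψ η s).1 (S.f e (replace ψ η s).2)) t := by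
    refine DifferentiableAt.comp t
      (g := fun y : (Fin d → ℝ) × (Fin a → ℝ) => S.posterior y.2 y.1)
      (f := fun s => (S.f e (replace ψ η s).2, (replace ψ η s).1)) ?_ (hf.prodMk hr1)
    exact hS.posterior_diff.differentiableAt
      ((isOpen_univ.prod hS.isOpen_Θ).mem_nhds ⟨Set.mem_univ _, ht.1⟩)
  have hqd : DifferentiableAt ℝ
      (fun s => S.q (replace ψ η s).2 (S.f e (replace ψ η s).2)) t := by
    refine DifferentiableAt.comp t
      (g := fun y : (Fin d → ℝ) × (Fin b → ℝ) => S.q y.2 y.1)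
      (f := fun s => (S.f e (replace ψ η s).2, (replace ψ η s).2)) ?_ (hf.prodMk hr2)
    exact hS.q_diff.differentiableAt
      ((isOpen_univ.prod hS.isOpen_Φ).mem_nhds ⟨Set.mem_univ _, ht.2⟩)
  have hm : DifferentiableAt ℝ (fun s => S.marginal (replace ψ η s).1) t :=
    DifferentiableAt.comp t (g := S.marginal) (f := fun s => (replace ψ η s).1)
      (hS.marginal_diff.differentiableAt hΘ) hr1
  refine ((hpost.mul hm).div hqd hq.ne').congr_of_eventuallyEq ?_
  have hev : ∀ᶠ s in 𝓝 t, (replace ψ η s).1 ∈ S.Θ := hr1.continuousAt hΘ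
  filter_upwards [hev] with s hs
  simp only [tw, weight, Pi.div_apply, Pi.mul_apply]
  rw [hS.joint_eq hs ⟨_, ht.2⟩]

/-- Expressed through the logarithmic derivative, so that it matches both the domination condition
and the summands of the estimator. -/
lemma hasDerivAt_rpow_log {g : ℝ → ℝ} {t c : ℝ} (hg : DifferentiableAt ℝ g t) (ht : 0 < g t) :
    HasDerivAt (fun s => g s ^ c) (c * (g t ^ c * deriv (fun s => Real.log (g s)) t)) t := by
  have h1 := hg.hasDerivAt.rpow_const (p := c) (Or.inl ht.ne')
  have h2 := (hg.hasDerivAt.log ht.ne').deriv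
  convert h1 using 1
  rw [h2, Real.rpow_sub ht, Real.rpow_one]
  field_simp

/-- The consequences of the domination condition along the coordinate line of `ψ`. -/
lemma Standing.exists_interval (hS : S.Standing) {α : ℝ} {ψ : Fin a ⊕ Fin b}
    (hdom : S.Domination α ψ) {η : Param a b} (hη : η ∈ S.Θ ×ˢ S.Φ) :
    ∃ r > 0, (∀ t ∈ Set.Ioo (component ψ η - r) (component ψ η + r),
        replace ψ η t ∈ S.Θ ×ˢ S.Φ) ∧
      (∀ᵐ e ∂S.Q, ∀ t ∈ Set.Ioo (component ψ η - r) (component ψ η + r),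
        0 < S.tw e (replace ψ η t) ∧
        DifferentiableAt ℝ (fun s => S.tw e (replace ψ η s)) t) ∧
      ∀ l ∈ ({1, 2} : Set ℝ), ∫⁻ e, (⨆ t ∈ Set.Ioo (component ψ η - r) (component ψ η + r),
        ENNReal.ofReal |deriv (fun s => S.tw e (replace ψ η s) ^ (l * (1 - α))) t|) ∂S.Q < ⊤ := by
  obtain ⟨V, ⟨r, hr, hrV⟩, hVsub, hpos, hsup⟩ := hdom η hη
  have hae : ∀ᵐ e ∂S.Q, ∀ t ∈ Set.Ioo (component ψ η - r) (component ψ η + r),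
      0 < S.tw e (replace ψ η t) ∧
      DifferentiableAt ℝ (fun s => S.tw e (replace ψ η s)) t := by
    filter_upwards [hpos, hS.f_diff] with e he hfe t ht
    have h1 := he _ (hrV t ht)
    exact ⟨div_pos h1.1 h1.2, hS.differentiableAt_tw hfe ψ η (hVsub (hrV t ht)) h1.2⟩
  refine ⟨r, hr, fun t ht => hVsub (hrV t ht), hae, fun l hl => ?_⟩
  have hl' : l ∈ ({0, 1, 2} : Set ℝ) := Or.inr hl
  -- The derivative of `w̃^{l(1-α)}` is `l(1-α)` times the dominated expression, and the interval is
  -- part of `V`.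
  refine lt_of_le_of_lt ?_ (ENNReal.mul_lt_top (a := ENNReal.ofReal |l * (1 - α)|)
    ENNReal.ofReal_lt_top (hsup l hl'))
  rw [← lintegral_const_mul' _ _ ENNReal.ofReal_ne_top]
  refine lintegral_mono_ae ?_
  filter_upwards [hae] with e he
  refine iSup₂_le fun t ht => ?_
  rw [(hasDerivAt_rpow_log (he t ht).2 (he t ht).1).deriv, abs_mul,
    ENNReal.ofReal_mul (abs_nonneg _), ← pderiv_replace ψ η fun η' => Real.log (S.tw e η')]
  gcongr
  exact le_iSup₂_of_le (f := fun η' (_ : η' ∈ V) => ENNReal.ofReal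
    |S.tw e η' ^ (l * (1 - α)) * pderiv ψ (fun η'' => Real.log (S.tw e η'')) η'|)
    (replace ψ η t) (hrV t ht) le_rfl

end Model

lemma memLp_two_of_lintegral_rpow {E : Type*} [MeasurableSpace E] {Q : Measure E}
    [IsFiniteMeasure Q] {f : E → ℝ} (hf : AEStronglyMeasurable f Q) {p : ℝ} (hp : 2 < p)
    (hint : ∫⁻ e, ENNReal.ofReal (|f e| ^ p) ∂Q < ⊤) : MemLp f 2 Q := by
  have hp0 : 0 < p := by linarith
  have key : MemLp f (ENNReal.ofReal p) Q := by
    refine ⟨hf, (eLpNorm_lt_top_iff_lintegral_rpow_enorm_lt_top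
      (ENNReal.ofReal_pos.2 hp0).ne' ENNReal.ofReal_ne_top).2 ?_⟩
    rw [ENNReal.toReal_ofReal hp0.le]
    refine lt_of_le_of_lt (lintegral_mono fun e => ?_) hint
    rw [Real.enorm_eq_ofReal_abs, ENNReal.ofReal_rpow_of_nonneg (abs_nonneg _) hp0.le]
  refine key.mono_exponent ?_
  rw [← ENNReal.ofReal_ofNat 2]
  exact ENNReal.ofReal_le_ofReal hp.le

/-! ### Moments of the powered weight and the derivatives of the VR bound and of `γ_α²`. -/

namespace Model

variable {a b d : ℕ} {E : Type*} [MeasurableSpace E] {S : Model a b d E}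

/-- The power `w̃^{1-α}` of the reparameterized weight. -/
def powWeight (S : Model a b d E) (α : ℝ) (η : Param a b) (e : E) : ℝ := S.tw e η ^ (1 - α)

/-- The partial derivative of `w̃^{1-α}`. -/
def derivWeight (S : Model a b d E) (α : ℝ) (ψ : Fin a ⊕ Fin b) (η : Param a b) (e : E) : ℝ :=
  pderiv ψ (fun η' => S.tw e η' ^ (1 - α)) η

lemma Standing.aemeasurable_powWeight (hS : S.Standing) (α : ℝ) {η : Param a b}
    (hη : η ∈ S.Θ ×ˢ S.Φ) : AEMeasurable (S.powWeight α η) S.Q :=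
  (hS.aemeasurable_tw hη).pow_const _

lemma Standing.ae_regular (hS : S.Standing) {α : ℝ} {ψ : Fin a ⊕ Fin b}
    (hdom : S.Domination α ψ) {η : Param a b} (hη : η ∈ S.Θ ×ˢ S.Φ) :
    ∀ᵐ e ∂S.Q, 0 < S.powWeight α η e ∧
      PDiffAt ψ (fun η' => S.powWeight α η' e) η ∧
      PDiffAt ψ (fun η' => Real.log (S.tw e η')) η ∧
      S.derivWeight α ψ η e =
        (1 - α) * (S.powWeight α η e * pderiv ψ (fun η' => Real.log (S.tw e η')) η) := by
  obtain ⟨r, hr, -, hae, -⟩ := hS.exists_interval hdom hη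
  filter_upwards [hae] with e he
  obtain ⟨hpos, hdiff⟩ := he (component ψ η) ⟨by linarith, by linarith⟩
  have hder := hasDerivAt_rpow_log (c := 1 - α) hdiff hpos
  have heq := hder.deriv
  rw [replace_component] at hpos heq
  refine ⟨Real.rpow_pos_of_pos hpos _, hder.differentiableAt, hdiff.log ?_, heq⟩
  rw [replace_component]
  exact hpos.ne'

lemma Standing.aemeasurable_derivWeight (hS : S.Standing) {α : ℝ} {ψ : Fin a ⊕ Fin b}
    (hdom : S.Domination α ψ) {η : Param a b} (hη : η ∈ S.Θ ×ˢ S.Φ) :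
    AEMeasurable (S.derivWeight α ψ η) S.Q := by
  obtain ⟨r, hr, hmem, -, -⟩ := hS.exists_interval hdom hη
  exact (aestronglyMeasurable_deriv (F := fun e t => S.powWeight α (replace ψ η t) e) hr
    (fun t ht => (hS.aemeasurable_powWeight α (hmem t ht)).aestronglyMeasurable)
    ((hS.ae_regular hdom hη).mono fun e he => he.2.1)).aemeasurable

lemma Standing.memLp_powWeight (hS : S.Standing) {α h : ℝ} {ψ : Fin a ⊕ Fin b}
    (hdom : S.Domination α ψ) {η : Param a b} (hη : η ∈ S.Θ ×ˢ S.Φ) (hh : 2 < h)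
    (hw : S.WeightMoment α h η) : MemLp (S.powWeight α η) 2 S.Q := by
  have := hS.isProbability
  refine memLp_two_of_lintegral_rpow (hS.aemeasurable_powWeight α hη).aestronglyMeasurable hh
    (lt_of_le_of_lt (le_of_eq (lintegral_congr_ae ?_)) hw)
  obtain ⟨r, hr, -, hae, -⟩ := hS.exists_interval hdom hη
  filter_upwards [hae] with e he
  have hpos := (he (component ψ η) ⟨by linarith, by linarith⟩).1
  rw [replace_component] at hpos
  rw [powWeight, abs_of_nonneg (Real.rpow_nonneg hpos.le _), ← Real.rpow_mul hpos.le]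

lemma Standing.memLp_derivWeight (hS : S.Standing) {α h' : ℝ} {ψ : Fin a ⊕ Fin b}
    (hdom : S.Domination α ψ) {η : Param a b} (hη : η ∈ S.Θ ×ˢ S.Φ) (hh' : 2 < h')
    (hd : S.DerivMoment α h' ψ η) : MemLp (S.derivWeight α ψ η) 2 S.Q := by
  have := hS.isProbability
  exact memLp_two_of_lintegral_rpow
    (hS.aemeasurable_derivWeight hdom hη).aestronglyMeasurable hh' hd

/-- The moments of `w̃^{1-α}` are differentiable along the coordinate line of `ψ`. -/
lemma Standing.hasDerivAt_moments (hS : S.Standing) {α : ℝ} {ψ : Fin a ⊕ Fin b}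
    (hdom : S.Domination α ψ) {η : Param a b} (hη : η ∈ S.Θ ×ˢ S.Φ)
    (hX : MemLp (S.powWeight α η) 2 S.Q) :
    HasDerivAt (fun t => ∫ e, S.powWeight α (replace ψ η t) e ∂S.Q)
        (∫ e, S.derivWeight α ψ η e ∂S.Q) (component ψ η) ∧
      HasDerivAt (fun t => ∫ e, S.powWeight α (replace ψ η t) e ^ 2 ∂S.Q)
        (2 * ∫ e, S.derivWeight α ψ η e * S.powWeight α η e ∂S.Q) (component ψ η) ∧
      ∀ᶠ t in 𝓝 (component ψ η), replace ψ η t ∈ S.Θ ×ˢ S.Φ ∧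
        MemLp (S.powWeight α (replace ψ η t)) 2 S.Q := by
  have := hS.isProbability
  obtain ⟨r, hr, hmem, hae, hsup⟩ := hS.exists_interval hdom hη
  have hI : Set.Ioo (component ψ η - r) (component ψ η + r) ∈ 𝓝 (component ψ η) :=
    Ioo_mem_nhds (by linarith) (by linarith)
  have hc : component ψ η ∈ Set.Ioo (component ψ η - r) (component ψ η + r) :=
    mem_of_mem_nhds hI
  have hm : ∀ t ∈ Set.Ioo (component ψ η - r) (component ψ η + r),
      AEStronglyMeasurable (S.powWeight α (replace ψ η t)) S.Q := fun t ht =>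
    (hS.aemeasurable_powWeight α (hmem t ht)).aestronglyMeasurable
  have hd1 : ∀ᵐ e ∂S.Q, ∀ t ∈ Set.Ioo (component ψ η - r) (component ψ η + r),
      DifferentiableAt ℝ (fun t => S.powWeight α (replace ψ η t) e) t := by
    filter_upwards [hae] with e he t ht
    exact (hasDerivAt_rpow_log (he t ht).2 (he t ht).1).differentiableAt
  -- The square is the power `2(1-α)`, so the domination with `l = 2` governs the second moment, as
  -- `l = 1` governs the first.
  have hsq : ∀ᵐ e ∂S.Q, ∀ t ∈ Set.Ioo (component ψ η - r) (component ψ η + r),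
      deriv (fun t => S.powWeight α (replace ψ η t) e ^ 2) t =
        deriv (fun s => S.tw e (replace ψ η s) ^ (2 * (1 - α))) t := by
    filter_upwards [hae] with e he t ht
    refine Filter.EventuallyEq.deriv_eq ?_
    filter_upwards [Ioo_mem_nhds ht.1 ht.2] with s hs
    rw [powWeight, mul_comm, Real.rpow_mul (he s hs).1.le, Real.rpow_two]
  have A := hasDerivAt_integral_of_lintegral_iSup_deriv
    (F := fun e t => S.powWeight α (replace ψ η t) e) (Q := S.Q) hr hm
    (by simpa using hX.integrable (by norm_num)) hd1 (by
      simpa only [one_mul, powWeight] using hsup 1 (by simp))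
  have B := hasDerivAt_integral_of_lintegral_iSup_deriv
    (F := fun e t => S.powWeight α (replace ψ η t) e ^ 2) (Q := S.Q) hr
    (fun t ht => (hm t ht).pow 2) (by simpa using hX.integrable_sq)
    (hd1.mono fun e he t ht => (he t ht).pow 2) (by
      refine lt_of_le_of_lt (lintegral_mono_ae ?_) (hsup 2 (by simp))
      filter_upwards [hsq] with e he
      exact iSup₂_mono fun t ht => by rw [he t ht])
  refine ⟨A.1, ?_, ?_⟩
  · convert B.1 using 1
    rw [← integral_const_mul]
    refine integral_congr_ae ?_
    filter_upwards [hd1] with e he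
    rw [((he _ hc).hasDerivAt.fun_pow 2).deriv]
    simp only [replace_component, derivWeight, pderiv, powWeight]
    push_cast
    ring
  -- Square integrability at nearby parameters is needed because the moment formula for `γ_α²` must
  -- hold in a neighbourhood before it is differentiated.
  · filter_upwards [hI, B.2] with t ht hB
    exact ⟨hmem t ht, (memLp_two_iff_integrable_sq (hm t ht)).2 hB⟩

lemma Standing.integral_qLaw (hS : S.Standing) {η : Param a b} (hη : η ∈ S.Θ ×ˢ S.Φ)
    {g : (Fin d → ℝ) → ℝ} (hg : Measurable g) :
    ∫ z, g z ∂S.qLaw η.2 = ∫ e, g (S.f e η.2) ∂S.Q :=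
  ((hS.f_law η.2 hη.2).integral_comp hg.aestronglyMeasurable).symm

lemma Standing.integral_powWeight_pos (hS : S.Standing) {α : ℝ} {ψ : Fin a ⊕ Fin b}
    (hdom : S.Domination α ψ) {η : Param a b} (hη : η ∈ S.Θ ×ˢ S.Φ)
    (hX : MemLp (S.powWeight α η) 2 S.Q) : 0 < ∫ e, S.powWeight α η e ∂S.Q := by
  have := hS.isProbability
  have hpos : ∀ᵐ e ∂S.Q, 0 < S.powWeight α η e :=
    (hS.ae_regular hdom hη).mono fun e he => he.1
  rw [integral_pos_iff_support_of_nonneg_ae (hpos.mono fun e he => he.le)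
    (hX.integrable (by norm_num))]
  refine pos_iff_ne_zero.2 fun h0 => ?_
  obtain ⟨e, he, he'⟩ := ((measure_eq_zero_iff_ae_notMem.1 h0).and hpos).exists
  exact he he'.ne'

lemma Standing.VR_eq (hS : S.Standing) (α : ℝ) {η : Param a b} (hη : η ∈ S.Θ ×ˢ S.Φ) :
    S.VR α η = 1 / (1 - α) * Real.log (∫ e, S.powWeight α η e ∂S.Q) := by
  rw [VR, hS.integral_qLaw hη ((hS.measurable_weight hη).pow_const _)]
  rfl

lemma Standing.gammaSq_eq (hS : S.Standing) {α : ℝ} {η : Param a b} (hη : η ∈ S.Θ ×ˢ S.Φ)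
    (hX : MemLp (S.powWeight α η) 2 S.Q) (hpos : 0 < ∫ e, S.powWeight α η e ∂S.Q) :
    S.gammaSq α η = 1 / (1 - α) *
      ((∫ e, S.powWeight α η e ^ 2 ∂S.Q) / (∫ e, S.powWeight α η e ∂S.Q) ^ 2 - 1) := by
  have := hS.isProbability
  have hm : Measurable (fun z => S.weight η z ^ (1 - α)) := (hS.measurable_weight hη).pow_const _
  have hint : ∫ z, S.weight η z ^ (1 - α) ∂S.qLaw η.2 = ∫ e, S.powWeight α η e ∂S.Q :=
    hS.integral_qLaw hη hm
  have hvar : Var[fun z => S.weight η z ^ (1 - α); S.qLaw η.2] = Var[S.powWeight α η; S.Q] := by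
    rw [← (hS.f_law η.2 hη.2).map_eq, variance_map hm.aemeasurable
      (hS.f_law η.2 hη.2).aemeasurable]
    rfl
  rw [gammaSq, hint]
  simp_rw [div_eq_inv_mul (_ ^ (1 - α) : ℝ)]
  rw [variance_const_mul, hvar, variance_eq_sub hX]
  simp only [Pi.pow_apply]
  field_simp

/-- The derivatives of the VR bound and of `γ_α²`. -/
lemma Standing.hasDerivAt_VR_gammaSq (hS : S.Standing) {α : ℝ} {ψ : Fin a ⊕ Fin b}
    (hdom : S.Domination α ψ) {η : Param a b} (hη : η ∈ S.Θ ×ˢ S.Φ)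
    (hX : MemLp (S.powWeight α η) 2 S.Q) :
    HasDerivAt (fun t => S.VR α (replace ψ η t)) (1 / (1 - α) *
        ((∫ e, S.derivWeight α ψ η e ∂S.Q) / ∫ e, S.powWeight α η e ∂S.Q)) (component ψ η) ∧
      HasDerivAt (fun t => S.gammaSq α (replace ψ η t)) (1 / (1 - α) *
        (2 * (∫ e, S.derivWeight α ψ η e * S.powWeight α η e ∂S.Q) /
            (∫ e, S.powWeight α η e ∂S.Q) ^ 2 -
          2 * (∫ e, S.powWeight α η e ^ 2 ∂S.Q) * (∫ e, S.derivWeight α ψ η e ∂S.Q) /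
            (∫ e, S.powWeight α η e ∂S.Q) ^ 3)) (component ψ η) := by
  obtain ⟨h1, h2, hev⟩ := hS.hasDerivAt_moments hdom hη hX
  have hpos := hS.integral_powWeight_pos hdom hη hX
  have hpos' : 0 < ∫ e, S.powWeight α (replace ψ η (component ψ η)) e ∂S.Q := by
    rwa [replace_component]
  constructor
  · have hlog := (h1.log hpos'.ne').const_mul (1 / (1 - α))
    rw [replace_component] at hlog
    refine hlog.congr_of_eventuallyEq ?_
    filter_upwards [hev] with t ht using hS.VR_eq α ht.1
  · have hdiv := ((h2.div (h1.pow 2) (pow_pos hpos' 2).ne').sub_const 1).const_mul (1 / (1 - α))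
    refine HasDerivAt.congr_of_eventuallyEq (f := fun t => 1 / (1 - α) *
      ((∫ e, S.powWeight α (replace ψ η t) e ^ 2 ∂S.Q) /
        (∫ e, S.powWeight α (replace ψ η t) e ∂S.Q) ^ 2 - 1)) ?_ ?_
    · refine hdiv.congr_deriv ?_
      simp only [Pi.pow_apply, replace_component]
      field_simp
      push_cast
      ring
    · filter_upwards [hev] with t ht
      exact hS.gammaSq_eq ht.1 ht.2 (hS.integral_powWeight_pos hdom ht.1 ht.2)

lemma Standing.hasDerivAt_normalizedWeight (hS : S.Standing) {α : ℝ} {ψ : Fin a ⊕ Fin b}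
    (hdom : S.Domination α ψ) {η : Param a b} (hη : η ∈ S.Θ ×ˢ S.Φ)
    (hX : MemLp (S.powWeight α η) 2 S.Q) :
    ∀ᵐ e ∂S.Q, HasDerivAt (fun t => S.normalizedWeight α e (replace ψ η t))
      ((∫ e, S.powWeight α η e ∂S.Q)⁻¹ * (S.derivWeight α ψ η e -
        (∫ e, S.derivWeight α ψ η e ∂S.Q) / (∫ e, S.powWeight α η e ∂S.Q) *
          S.powWeight α η e)) (component ψ η) := by
  have h1 := (hS.hasDerivAt_moments hdom hη hX).1
  have hpos := hS.integral_powWeight_pos hdom hη hX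
  filter_upwards [hS.ae_regular hdom hη] with e he
  have hder : HasDerivAt (fun t => S.powWeight α (replace ψ η t) e) (S.derivWeight α ψ η e)
    (component ψ η) := DifferentiableAt.hasDerivAt he.2.1
  have hdiv := hder.div h1 (by rw [replace_component]; exact hpos.ne')
  refine hdiv.congr_deriv ?_
  simp only [replace_component]
  field_simp

end Model

/-! ### Independent blocks of noise and their average. -/

section Estimator

variable {Ω E : Type*} [MeasurableSpace Ω] [MeasurableSpace E] {P : Measure Ω} {Q : Measure E}

/-- The sample of pairs `(x, u)` in the block `m`. -/
def blockPairs (x u : E → ℝ) (ε : ℕ → ℕ → Ω → E) (m : ℕ) : ℕ → Ω → ℝ × ℝ :=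
  fun j ω => (x (ε m j ω), u (ε m j ω))

variable {x u : E → ℝ} {ε : ℕ → ℕ → Ω → E}

lemma hasLaw_block (hlaw : ∀ m j, HasLaw (ε m j) Q P)
    (hindep : iIndepFun (fun i : ℕ × ℕ => ε i.1 i.2) P) (m N : ℕ) :
    HasLaw (fun ω (j : Fin N) => ε m j ω) (Measure.pi fun _ => Q) P :=
  iIndepFun.hasLaw_pi (X := fun (j : Fin N) ω => ε m j ω) (fun j => hlaw m j)
    (hindep.precomp (g := fun j : Fin N => (m, (j : ℕ))) fun i j hij => by
      simpa [Fin.ext_iff] using hij)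

lemma ratio_blockPairs (m N : ℕ) (ω : Ω) :
    IsRatioSequence.ratio (blockPairs x u ε m) N ω =
      (∑ j ∈ Finset.range N, u (ε m j ω)) / ∑ j ∈ Finset.range N, x (ε m j ω) := by
  rw [IsRatioSequence.ratio, IsRatioSequence.snd_partialSum, IsRatioSequence.fst_partialSum]
  rfl

lemma isRatioSequence_blockPairs [IsProbabilityMeasure P] (mε : ∀ m j, Measurable (ε m j))
    (hlaw : ∀ m j, HasLaw (ε m j) Q P) (hindep : iIndepFun (fun i : ℕ × ℕ => ε i.1 i.2) P)
    (mx : Measurable x) (mu : Measurable u) (hx : ∀ e, 0 < x e) (hx2 : MemLp x 2 Q)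
    (hu2 : MemLp u 2 Q) (hu : ∫ e, u e ∂Q = 0) {n : ℕ} (hn : 1 ≤ n)
    (hinv : Integrable (fun e : Fin n → E => (∑ j, x (e j))⁻¹) (Measure.pi fun _ => Q)) (m : ℕ) :
    IsRatioSequence (blockPairs x u ε m) P where
  isProbability := inferInstance
  meas j := (mx.comp (mε m j)).prodMk (mu.comp (mε m j))
  indep := (hindep.precomp (g := fun j : ℕ => (m, j)) fun i j hij => by simpa using hij).comp
    (fun _ e => (x e, u e)) fun _ => mx.prodMk mu
  ident j := ((hlaw m j).identDistrib (hlaw m 0)).comp (u := fun e => (x e, u e)) (mx.prodMk mu)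
  pos j ω := hx _
  memLp_fst := hx2.comp_measurePreserving ((hlaw m 0).measurePreserving (mε m 0))
  memLp_snd := hu2.comp_measurePreserving ((hlaw m 0).measurePreserving (mε m 0))
  integral_snd := ((hlaw m 0).integral_comp mu.aestronglyMeasurable).trans hu
  inv_integrable := by
    refine ⟨n, hn, ?_⟩
    have hb := hasLaw_block hlaw hindep m n
    rw [← hb.map_eq] at hinv
    refine (hinv.comp_aemeasurable hb.aemeasurable).congr (ae_of_all _ fun ω => ?_)
    simp only [IsRatioSequence.fst_partialSum, Function.comp, blockPairs]
    rw [Finset.sum_range]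

lemma identDistrib_ratio (hlaw : ∀ m j, HasLaw (ε m j) Q P)
    (hindep : iIndepFun (fun i : ℕ × ℕ => ε i.1 i.2) P) (mx : Measurable x) (mu : Measurable u)
    (m N : ℕ) :
    IdentDistrib (IsRatioSequence.ratio (blockPairs x u ε m) N)
      (IsRatioSequence.ratio (blockPairs x u ε 0) N) P P := by
  have := ((hasLaw_block hlaw hindep m N).identDistrib (hasLaw_block hlaw hindep 0 N)).comp
    (u := fun e : Fin N → E => (∑ j, u (e j)) / ∑ j, x (e j)) (by fun_prop)
  convert this using 1 <;>
  · ext ω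
    simp only [ratio_blockPairs, Function.comp, Finset.sum_range]

lemma indepFun_ratio (mε : ∀ m j, Measurable (ε m j))
    (hindep : iIndepFun (fun i : ℕ × ℕ => ε i.1 i.2) P) (mx : Measurable x) (mu : Measurable u)
    {m m' : ℕ} (hm : m ≠ m') (N : ℕ) :
    IndepFun (IsRatioSequence.ratio (blockPairs x u ε m) N)
      (IsRatioSequence.ratio (blockPairs x u ε m') N) P := by
  have hdisj : Disjoint ({m} ×ˢ Finset.range N) ({m'} ×ˢ Finset.range N) :=
    Finset.disjoint_product.2 (Or.inl (by simpa using hm))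
  have key := hindep.indepFun_finset _ _ hdisj fun i => mε i.1 i.2
  have hF : ∀ k : ℕ, Measurable (fun e : ({k} ×ˢ Finset.range N : Finset (ℕ × ℕ)) → E =>
      (∑ i, u (e i)) / ∑ i, x (e i)) := fun k => by fun_prop
  have hsum : ∀ (k : ℕ) (g : E → ℝ) (ω : Ω),
      ∑ i : ({k} ×ˢ Finset.range N : Finset (ℕ × ℕ)), g (ε i.1.1 i.1.2 ω) =
        ∑ j ∈ Finset.range N, g (ε k j ω) := fun k g ω => by
    rw [Finset.sum_coe_sort _ fun i : ℕ × ℕ => g (ε i.1 i.2 ω), Finset.sum_product]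
    simp
  convert key.comp (hF m) (hF m') using 1 <;>
  · ext ω
    rw [ratio_blockPairs]
    simp only [Function.comp, hsum]

/-- Mean and variance of the average of `M` independent copies of the ratio. -/
lemma integral_variance_average_ratio [IsProbabilityMeasure P] (mε : ∀ m j, Measurable (ε m j))
    (hlaw : ∀ m j, HasLaw (ε m j) Q P)
    (hindep : iIndepFun (fun i : ℕ × ℕ => ε i.1 i.2) P) (mx : Measurable x) (mu : Measurable u)
    {N M : ℕ} (hM : 1 ≤ M) (hL : MemLp (IsRatioSequence.ratio (blockPairs x u ε 0) N) 2 P)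
    (k c : ℝ) :
    MemLp (fun ω => 1 / (M : ℝ) * ∑ m ∈ Finset.range M,
        k * (c + IsRatioSequence.ratio (blockPairs x u ε m) N ω)) 2 P ∧
      ∫ ω, 1 / (M : ℝ) * ∑ m ∈ Finset.range M,
        k * (c + IsRatioSequence.ratio (blockPairs x u ε m) N ω) ∂P =
          k * (c + ∫ ω, IsRatioSequence.ratio (blockPairs x u ε 0) N ω ∂P) ∧
      Var[fun ω => 1 / (M : ℝ) * ∑ m ∈ Finset.range M,
        k * (c + IsRatioSequence.ratio (blockPairs x u ε m) N ω); P] =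
          k ^ 2 * Var[IsRatioSequence.ratio (blockPairs x u ε 0) N; P] / M := by
  have hM0 : (0 : ℝ) < M := by exact_mod_cast hM
  have hid := identDistrib_ratio hlaw hindep mx mu (N := N)
  have hLm : ∀ m, MemLp (IsRatioSequence.ratio (blockPairs x u ε m) N) 2 P := fun m =>
    (hid m).memLp_iff.2 hL
  have hLk : ∀ m, MemLp (fun ω => k * (c + IsRatioSequence.ratio (blockPairs x u ε m) N ω)) 2 P :=
    fun m => ((memLp_const c).add (hLm m)).const_mul k
  refine ⟨(memLp_finsetSum _ fun m _ => hLk m).const_mul _, ?_, ?_⟩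
  · rw [integral_const_mul, integral_finsetSum _ fun m _ => (hLk m).integrable (by norm_num)]
    have : ∀ m, ∫ ω, k * (c + IsRatioSequence.ratio (blockPairs x u ε m) N ω) ∂P =
        k * (c + ∫ ω, IsRatioSequence.ratio (blockPairs x u ε 0) N ω ∂P) := fun m => by
      rw [integral_const_mul, integral_add (integrable_const c) ((hLm m).integrable (by norm_num)),
        (hid m).integral_eq]
      simp
    simp only [this, Finset.sum_const, Finset.card_range, nsmul_eq_mul]
    field_simp
  · have hv : ∀ m, Var[fun ω => k * (c + IsRatioSequence.ratio (blockPairs x u ε m) N ω); P] =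
        k ^ 2 * Var[IsRatioSequence.ratio (blockPairs x u ε 0) N; P] := fun m => by
      rw [variance_const_mul, variance_const_add (hLm m).aestronglyMeasurable, (hid m).variance_eq]
    have hs := IndepFun.variance_sum (μ := P) (s := Finset.range M)
      (X := fun m ω => k * (c + IsRatioSequence.ratio (blockPairs x u ε m) N ω))
      (fun m _ => hLk m) fun m _ m' _ hmm =>
        (indepFun_ratio mε hindep mx mu hmm N).comp (φ := fun y => k * (c + y))
          (ψ := fun y => k * (c + y)) (by fun_prop) (by fun_prop)
    rw [variance_const_mul, show (fun ω => ∑ m ∈ Finset.range M,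
      k * (c + IsRatioSequence.ratio (blockPairs x u ε m) N ω)) = ∑ m ∈ Finset.range M,
      fun ω => k * (c + IsRatioSequence.ratio (blockPairs x u ε m) N ω) by ext ω; simp, hs]
    simp only [hv, Finset.sum_const, Finset.card_range, nsmul_eq_mul]
    field_simp

/-- Extracts the factor `√(MN)` and leaves the rescaled variance `N v`. When `√v = 0` both sides
vanish by the convention for division by zero. -/
lemma sqrt_mul_div_sqrt {M N : ℕ} (hM : 1 ≤ M) (hN : 1 ≤ N) (y v : ℝ) :
    y / √(v / M) = √((M : ℝ) * N) * y / √(N * v) := by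
  have hM0 : (0 : ℝ) < M := by exact_mod_cast hM
  have hN0 : (0 : ℝ) < N := by exact_mod_cast hN
  have hM1 := Real.sqrt_pos.2 hM0
  have hN1 := Real.sqrt_pos.2 hN0
  rw [Real.sqrt_div' _ hM0.le, Real.sqrt_mul hM0.le, Real.sqrt_mul hN0.le]
  rcases eq_or_ne (√v) 0 with h | h
  · simp [h]
  · field_simp

end Estimator

/-! ### The negative moment condition and the estimator in terms of ratios. -/

namespace Model

variable {a b d : ℕ} {E : Type*} [MeasurableSpace E] {S : Model a b d E}

/-- For `y > 0` and `μ > 1` one has `y⁻¹ ≤ 1 + y^{-μ}`. Order one suffices here, since higher orders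
are recovered from independent blocks. -/
lemma NegativeMoment.exists_integrable_inv [IsProbabilityMeasure S.Q] {α : ℝ} {η : Param a b}
    (hneg : S.NegativeMoment α η) {x : E → ℝ} (mx : Measurable x) (hx : ∀ e, 0 < x e)
    (hxw : ∀ᵐ e ∂S.Q, x e = S.powWeight α η e) :
    ∃ n : ℕ, 1 ≤ n ∧
      Integrable (fun e : Fin n → E => (∑ j, x (e j))⁻¹) (Measure.pi fun _ => S.Q) := by
  obtain ⟨μ, hμ, n, hn, hfin⟩ := hneg
  have hn0 : (0 : ℝ) < n := by exact_mod_cast hn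
  have : Nonempty (Fin n) := ⟨⟨0, hn⟩⟩
  refine ⟨n, hn, ?_⟩
  have hae : ∀ᵐ e : Fin n → E ∂(Measure.pi fun _ => S.Q), ∀ j, x (e j) = S.powWeight α η (e j) :=
    ae_all_iff.2 fun j => (Measure.quasiMeasurePreserving_eval (fun _ : Fin n => S.Q) j).ae hxw
  set A : (Fin n → E) → ℝ := fun e => (n : ℝ)⁻¹ * ∑ j, x (e j) with hA
  have hApos : ∀ e, 0 < A e := fun e =>
    mul_pos (by positivity) (Finset.sum_pos (fun j _ => hx _) Finset.univ_nonempty)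
  have mA : Measurable A := by fun_prop
  have hint : Integrable (fun e => A e ^ (-μ)) (Measure.pi fun _ => S.Q) := by
    refine ⟨(mA.pow_const _).aestronglyMeasurable, ?_⟩
    rw [hasFiniteIntegral_iff_ofReal (ae_of_all _ fun e => Real.rpow_nonneg (hApos e).le _)]
    refine lt_of_le_of_lt (le_of_eq (lintegral_congr_ae ?_)) hfin
    filter_upwards [hae] with e he
    have : A e = (n : ℝ)⁻¹ * ∑ j, S.tw (e j) η ^ (1 - α) := by
      simp only [hA, he, powWeight]
    rw [← this, abs_of_pos (hApos e)]
  have hint2 : Integrable (fun e => (n : ℝ)⁻¹ * (1 + A e ^ (-μ))) (Measure.pi fun _ => S.Q) :=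
    ((integrable_const 1).add hint).const_mul _
  refine hint2.mono' (Measurable.aestronglyMeasurable (by fun_prop)) (ae_of_all _ fun e => ?_)
  have hs : 0 < ∑ j, x (e j) := Finset.sum_pos (fun j _ => hx _) Finset.univ_nonempty
  rw [Real.norm_of_nonneg (inv_nonneg.2 hs.le)]
  have e1 : (∑ j, x (e j))⁻¹ = (n : ℝ)⁻¹ * (A e)⁻¹ := by
    simp only [hA]; field_simp
  rw [e1]
  gcongr
  rcases le_total 1 (A e) with h1 | h1
  · have := inv_le_one_of_one_le₀ h1
    have := Real.rpow_nonneg (hApos e).le (-μ)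
    linarith
  · have : (A e)⁻¹ ≤ A e ^ (-μ) := by
      rw [← Real.rpow_neg_one]
      exact Real.rpow_le_rpow_of_exponent_ge (hApos e) h1 (by linarith)
    linarith

/-- Almost surely, the estimator is an affine function of ratios of sums. -/
lemma gradREP_ae_eq {Ω : Type*} [MeasurableSpace Ω] {P : Measure Ω} {α : ℝ} (hα : α < 1)
    {ψ : Fin a ⊕ Fin b} {η : Param a b} {ε ε' : ℕ → ℕ → Ω → E}
    (hlaw : ∀ m j, HasLaw (ε m j) S.Q P) (hε : ∀ m j, ε m j =ᵐ[P] ε' m j)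
    {x u : E → ℝ} {c : ℝ} (hx : ∀ e, 0 < x e)
    (hae : ∀ᵐ e ∂S.Q, x e = S.powWeight α η e ∧ u e + c * x e =
      (1 - α) * (S.powWeight α η e * pderiv ψ (fun η' => Real.log (S.tw e η')) η))
    {N : ℕ} (hN : 1 ≤ N) (M : ℕ) :
    (fun ω => S.gradREP α ψ η M N fun m j => ε m j ω) =ᵐ[P] fun ω =>
      1 / (M : ℝ) * ∑ m ∈ Finset.range M, 1 / (1 - α) *
        (c + IsRatioSequence.ratio (blockPairs x u ε' m) N ω) := by
  have h1α : 0 < 1 - α := by linarith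
  have hall : ∀ᵐ ω ∂P, ∀ m j, x (ε m j ω) = S.powWeight α η (ε m j ω) ∧
      u (ε m j ω) + c * x (ε m j ω) = (1 - α) * (S.powWeight α η (ε m j ω) *
        pderiv ψ (fun η' => Real.log (S.tw (ε m j ω) η')) η) := by
    refine ae_all_iff.2 fun m => ae_all_iff.2 fun j => ?_
    rw [← (hlaw m j).map_eq] at hae
    exact ae_of_ae_map (hlaw m j).aemeasurable hae
  have hε' : ∀ᵐ ω ∂P, ∀ m j, ε m j ω = ε' m j ω :=
    ae_all_iff.2 fun m => ae_all_iff.2 fun j => hε m j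
  filter_upwards [hall, hε'] with ω hω hω'
  rw [gradREP]
  congr 1
  refine Finset.sum_congr rfl fun m _ => ?_
  rw [ratio_blockPairs]
  simp only [← hω']
  set T := ∑ j ∈ Finset.range N, x (ε m j ω) with hT
  have hT0 : 0 < T := Finset.sum_pos (fun j _ => hx _) (by simp; omega)
  have hTw : ∑ l ∈ Finset.range N, S.tw (ε m l ω) η ^ (1 - α) = T :=
    Finset.sum_congr rfl fun l _ => (hω m l).1.symm
  rw [hTw]
  -- The normalized weights `x / T` sum to one over a block, so the part proportional to `c`
  -- collapses to the constant.
  have hterm : ∀ j, S.tw (ε m j ω) η ^ (1 - α) / T *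
      pderiv ψ (fun η' => Real.log (S.tw (ε m j ω) η')) η =
      1 / (1 - α) * (u (ε m j ω) / T + c * (x (ε m j ω) / T)) := fun j => by
    have h2 := (hω m j).2
    rw [powWeight] at h2
    have : u (ε m j ω) / T + c * (x (ε m j ω) / T) = (u (ε m j ω) + c * x (ε m j ω)) / T := by ring
    rw [this, h2]
    field_simp
  simp only [hterm]
  rw [← Finset.mul_sum, Finset.sum_add_distrib, ← Finset.mul_sum, ← Finset.sum_div,
    ← Finset.sum_div, ← hT, div_self hT0.ne']
  ring

end Model

end VRIWAE

end

/-! ### The expansion of the signal-to-noise ratio. -/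

theorem theorem2 {a b d : ℕ} {E : Type*} [MeasurableSpace E] (S : VRIWAE.Model a b d E)
    (hS : S.Standing) (α : ℝ) (hα : α ∈ Set.Ico (0 : ℝ) 1) (ψ : Fin a ⊕ Fin b)
    (η : VRIWAE.Param a b) (hη : η ∈ S.Θ ×ˢ S.Φ)
    (hneg : S.NegativeMoment α η)
    (h h' : ℝ) (hh : 2 < h) (hh' : 2 < h')
    (hw : S.WeightMoment α h η) (hd : S.DerivMoment α h' ψ η)
    (hdom : S.Domination α ψ)
    {Ω : Type*} [MeasurableSpace Ω] (P : Measure Ω) [IsProbabilityMeasure P]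
    (ε : ℕ → ℕ → Ω → E) (hlaw : ∀ m j, HasLaw (ε m j) S.Q P)
    (hindep : iIndepFun (fun (i : ℕ × ℕ) => ε i.1 i.2) P) :
    -- the derivatives and variances in the formula are well defined
    VRIWAE.PDiffAt ψ (S.VR α) η ∧
    VRIWAE.PDiffAt ψ (S.gammaSq α) η ∧
    (∀ᵐ e ∂S.Q, VRIWAE.PDiffAt ψ (fun η' => Real.log (S.tw e η')) η) ∧
    (∀ᵐ e ∂S.Q, VRIWAE.PDiffAt ψ (S.normalizedWeight α e) η) ∧
    MemLp (fun e => VRIWAE.pderiv ψ (S.normalizedWeight α e) η) 2 S.Q ∧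
    -- the expansion of the signal-to-noise ratio
    ∃ r s : ℕ → ℝ, r =o[atTop] (fun N : ℕ => 1 / (N : ℝ)) ∧ s =o[atTop] (fun _ : ℕ => (1 : ℝ)) ∧
      ∀ᶠ N : ℕ in atTop, ∀ M : ℕ, 1 ≤ M →
        MemLp (fun ω => S.gradREP α ψ η M N fun m j => ε m j ω) 2 P ∧
        VRIWAE.SNR (fun ω => S.gradREP α ψ η M N fun m j => ε m j ω) P =
          √((M : ℝ) * N) *
            |VRIWAE.pderiv ψ (S.VR α) η
              - 1 / (2 * (N : ℝ)) * VRIWAE.pderiv ψ (S.gammaSq α) η + r N| /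
            (√(S.vREP α ψ η) + s N) := by
  have hQ := hS.isProbability
  have hα1 : 0 < 1 - α := by linarith [hα.2]
  have hX := hS.memLp_powWeight hdom hη hh hw
  have hY := hS.memLp_derivWeight hdom hη hh' hd
  have hm := hS.integral_powWeight_pos hdom hη hX
  obtain ⟨hVR, hγ⟩ := hS.hasDerivAt_VR_gammaSq hdom hη hX
  have hreg := hS.ae_regular hdom hη
  have hnw := hS.hasDerivAt_normalizedWeight hdom hη hX
  have mX := hS.aemeasurable_powWeight α hη
  have mY := hS.aemeasurable_derivWeight hdom hη
  -- measurable versions of the weights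
  set m := ∫ e, S.powWeight α η e ∂S.Q with hm_def
  set c := (∫ e, S.derivWeight α ψ η e ∂S.Q) / m with hc
  -- The value `1` is used on a null set only; it makes `x` positive everywhere, as
  -- `IsRatioSequence` demands.
  set x : E → ℝ := fun e => if 0 < mX.mk _ e then mX.mk _ e else 1 with hx_def
  set u : E → ℝ := fun e => mY.mk _ e - c * x e with hu_def
  have mx : Measurable x :=
    Measurable.ite (measurableSet_lt measurable_const mX.measurable_mk) mX.measurable_mk
      measurable_const
  have mu : Measurable u := mY.measurable_mk.sub (mx.const_mul c)
  have hx : ∀ e, 0 < x e := fun e => by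
    simp only [hx_def]; split_ifs with h0
    · exact h0
    · exact one_pos
  have hxX : ∀ᵐ e ∂S.Q, x e = S.powWeight α η e := by
    filter_upwards [mX.ae_eq_mk, hreg] with e he hpos
    simp only [hx_def, ← he, if_pos hpos.1]
  have huY : ∀ᵐ e ∂S.Q, u e = S.derivWeight α ψ η e - c * S.powWeight α η e := by
    filter_upwards [hxX, mY.ae_eq_mk] with e h1 h2
    simp only [hu_def, h1, ← h2]
  have hx2 : MemLp x 2 S.Q := (memLp_congr_ae hxX).2 hX
  have hu2 : MemLp u 2 S.Q := (memLp_congr_ae huY).2 (hY.sub (hX.const_mul c))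
  have iX : Integrable (S.powWeight α η) S.Q := hX.integrable (by norm_num)
  have iY : Integrable (S.derivWeight α ψ η) S.Q := hY.integrable (by norm_num)
  have hxm : ∫ e, x e ∂S.Q = m := integral_congr_ae hxX
  have hu0 : ∫ e, u e ∂S.Q = 0 := by
    rw [integral_congr_ae huY, integral_sub iY (iX.const_mul c), integral_const_mul, hc, ← hm_def]
    field_simp
    ring
  have hux : ∫ e, u e * x e ∂S.Q = (∫ e, S.derivWeight α ψ η e * S.powWeight α η e ∂S.Q) -
      c * ∫ e, S.powWeight α η e ^ 2 ∂S.Q := by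
    have : (fun e => u e * x e) =ᵐ[S.Q] fun e =>
        S.derivWeight α ψ η e * S.powWeight α η e - c * S.powWeight α η e ^ 2 := by
      filter_upwards [hxX, huY] with e h1 h2
      rw [h1, h2]; ring
    have iYX : Integrable (fun e => S.derivWeight α ψ η e * S.powWeight α η e) S.Q :=
      hY.integrable_mul hX
    rw [integral_congr_ae this, integral_sub iYX (hX.integrable_sq.const_mul c),
      integral_const_mul]
  have hpVR : VRIWAE.pderiv ψ (S.VR α) η = 1 / (1 - α) * c := hVR.deriv
  have hpγ : VRIWAE.pderiv ψ (S.gammaSq α) η =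
      2 / (1 - α) * ((∫ e, u e * x e ∂S.Q) * m⁻¹ ^ 2) := by
    refine hγ.deriv.trans ?_
    rw [hux, hc]
    field_simp
  -- Differentiating the normalization subtracts exactly `c` times the weight, so the centred
  -- variable `u` appears and `v_REP` matches the limiting variance of the ratio.
  have hpn : ∀ᵐ e ∂S.Q, VRIWAE.pderiv ψ (S.normalizedWeight α e) η = m⁻¹ * u e := by
    filter_upwards [hnw, huY] with e h1 h2
    rw [h2]; exact h1.deriv
  have hvREP : S.vREP α ψ η = (1 / (1 - α)) ^ 2 * ((∫ e, u e ^ 2 ∂S.Q) * m⁻¹ ^ 2) := by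
    rw [VRIWAE.Model.vREP, variance_congr hpn, variance_const_mul,
      variance_of_integral_eq_zero mu.aemeasurable hu0, one_div_pow]
    ring
  -- measurable versions of the noise variables
  set ε' : ℕ → ℕ → Ω → E := fun m j => (hlaw m j).aemeasurable.mk _ with hε'
  have hεε' : ∀ m j, ε m j =ᵐ[P] ε' m j := fun m j => (hlaw m j).aemeasurable.ae_eq_mk
  have mε' : ∀ m j, Measurable (ε' m j) := fun m j => (hlaw m j).aemeasurable.measurable_mk
  have hlaw' : ∀ m j, HasLaw (ε' m j) S.Q P := fun m j => (hlaw m j).congr (hεε' m j).symm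
  have hindep' : iIndepFun (fun i : ℕ × ℕ => ε' i.1 i.2) P :=
    hindep.congr fun i => hεε' i.1 i.2
  obtain ⟨n, hn, hinv⟩ := hneg.exists_integrable_inv mx hx hxX
  have hZ := VRIWAE.isRatioSequence_blockPairs mε' hlaw' hindep' mx mu hx hx2 hu2 hu0 hn hinv 0
  set R := VRIWAE.IsRatioSequence.ratio (VRIWAE.blockPairs x u ε' 0) with hR
  have toQ : ∀ g : E → ℝ, Measurable g → ∫ ω, g (ε' 0 0 ω) ∂P = ∫ e, g e ∂S.Q := fun g hg =>
    (hlaw' 0 0).integral_comp hg.aestronglyMeasurable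
  have hbias : Tendsto (fun N : ℕ => (N : ℝ) * ∫ ω, R N ω ∂P) atTop
      (𝓝 (-((∫ e, u e * x e ∂S.Q) * m⁻¹ ^ 2))) := by
    have h1 := hZ.tendsto_mul_integral_ratio
    simp only [VRIWAE.blockPairs] at h1
    rwa [toQ (fun e => u e * x e) (mu.mul mx), toQ x mx, hxm] at h1
  have hvar : Tendsto (fun N : ℕ => (N : ℝ) * Var[R N; P]) atTop
      (𝓝 ((∫ e, u e ^ 2 ∂S.Q) * m⁻¹ ^ 2)) := by
    have h1 := hZ.tendsto_mul_variance_ratio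
    simp only [VRIWAE.blockPairs] at h1
    rwa [toQ (fun e => u e ^ 2) (mu.pow_const 2), toQ x mx, hxm] at h1
  -- The two remainders are the exact differences between the mean, respectively the rescaled
  -- standard deviation, of one block and the claimed main terms. The formula then holds
  -- identically, and only their orders remain to be shown.
  refine ⟨hVR.differentiableAt, hγ.differentiableAt, hreg.mono fun e he => he.2.2.1,
    hnw.mono fun e he => he.differentiableAt, (memLp_congr_ae hpn).2 (hu2.const_mul _),
    fun N => 1 / (1 - α) * (c + ∫ ω, R N ω ∂P) - VRIWAE.pderiv ψ (S.VR α) η +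
      1 / (2 * (N : ℝ)) * VRIWAE.pderiv ψ (S.gammaSq α) η,
    fun N => √(N * ((1 / (1 - α)) ^ 2 * Var[R N; P])) - √(S.vREP α ψ η), ?_, ?_, ?_⟩
  · refine (isLittleO_iff_tendsto' ?_).2 ?_
    · filter_upwards [eventually_ge_atTop 1] with N hN h0
      have hN0 : (0 : ℝ) < N := by exact_mod_cast hN
      exact absurd h0 (by positivity)
    · have h1 := (hbias.add_const ((∫ e, u e * x e ∂S.Q) * m⁻¹ ^ 2)).const_mul (1 / (1 - α))
      rw [neg_add_cancel, mul_zero] at h1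
      refine h1.congr' ?_
      filter_upwards [eventually_ge_atTop 1] with N hN
      have hN0 : (0 : ℝ) < N := by exact_mod_cast hN
      rw [hpVR, hpγ]
      field_simp
      ring
  · rw [isLittleO_one_iff]
    have h1 := (hvar.const_mul ((1 / (1 - α)) ^ 2)).sqrt.sub_const √(S.vREP α ψ η)
    rw [← hvREP, sub_self] at h1
    refine h1.congr fun N => ?_
    rw [mul_left_comm]
  -- The threshold on `N` comes from block `0` alone, and the other blocks have the same law; hence
  -- it does not depend on `M`.
  · filter_upwards [hZ.eventually_memLp_ratio, eventually_ge_atTop 1] with N hN hN1 M hM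
    have hG := VRIWAE.Model.gradREP_ae_eq (S := S) (ψ := ψ) (η := η) (u := u) (c := c) hα.2 hlaw
      hεε' hx (by
        filter_upwards [hxX, huY, hreg] with e h1 h2 h3
        refine ⟨h1, ?_⟩
        rw [h1, h2, ← h3.2.2.2]
        ring) hN1 M
    obtain ⟨hL, hmean, hv⟩ := VRIWAE.integral_variance_average_ratio mε' hlaw' hindep' mx mu hM hN
      (1 / (1 - α)) c
    refine ⟨(memLp_congr_ae hG).2 hL, ?_⟩
    rw [VRIWAE.SNR, integral_congr_ae hG, variance_congr hG, hmean, hv,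
      VRIWAE.sqrt_mul_div_sqrt hM hN1]
    congr 2
    · congr 1
      ring
    · ring
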